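/- Let $\varphi:(0,\infty)\to(0,\infty)$ satisfy the following conditions: (i) $\varphi\in C^1((0,\infty))$; (ii) $(s\varphi(s))'>0$ for every $s>0$; (iii) the range of $s\mapsto s\varphi(s)$ on $(0,\infty)$ is $(0,\infty)$; (iv) there are $C_1,C_2>0$, $r>-1$ and $s_0>0$ with $C_1s^r\le (s\varphi(s))'\le C_2s^r$ for $s\in(0,s_0)$; if $r=0$, moreover, $\lim_{s\to0^+}\varphi(s)$ exists, is finite and positive, and $\lim_{s\to0^+}s\varphi'(s)=0$; (v) there is $s_1>s_0$ such that either $\varphi'(s)\ge0$ for all $s\ge s_1$, or $\varphi'(s)\le0$ for all $s\ge s_1$; (vi) $s\mapsto|s\varphi'(s)/\varphi(s)|$ is non-decreasing on $(0,\infty)$. Define $\Lambda$ on $(0,\infty)$ by $$\Lambda\big(s\sqrt{\varphi(s)}\big)=-\frac{s\varphi'(s)}{s\varphi'(s)+2\varphi(s)}\quad(s>0),\qquad \Lambda_\infty=\lim_{t\to\infty}\Lambda(t),$$ and assume $\Lambda_\infty^2<1$. Let $(a,b)\subset\mathbb R$ be a bounded or unbounded open interval, let $\mathscr A(x)$, $x\in(a,b)$,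 be an $m\times m$ matrix with complex entries in $L^1_{\mathrm{loc}}((a,b))$, and consider the operator $Au=(\mathscr A u')'$. Write $\langle\xi,\eta\rangle=\sum_i\xi_i\overline{\eta_i}$ on $\mathbb C^m$, and let $C_0^1$ denote the space of $C^1$ functions with compact support. The operator $A$ is called $L^\Phi$-dissipative if $$\operatorname{Re}\int_a^b\langle\mathscr A u',(\varphi(|u|)u)'\rangle\,dx\ge0$$ for all $u\in[C^1_0((a,b))]^m$ with $\varphi(|u|)u\in[C^1_0((a,b))]^m$, and strictly $L^\Phi$-dissipative if there is $\kappa>0$ such that $$\operatorname{Re}\int_a^b\langle\mathscr A u',(\varphi(|u|)u)'\rangle\,dx\ge\kappa\int_a^b\big|(\sqrt{\varphi(|u|)}\,u)'\big|^2dx$$ for all such $u$ (products with $u$ are taken to be $0$ where $u=0$). Put $$P(x,\lambda,\omega)=\operatorname{Re}\langle\mathscr A(x)\lambda,\lambda\rangle-\Lambda_\infty^2\operatorname{Re}\langle\mathscr A(x)\omega,\omega\rangle(\operatorname{Re}\langle\lambda,\omega\rangle)^2+\Lambda_\infty\operatorname{Re}\big(\langle\mathscr A(x)\omega,\lambda\rangle-\langle\mathscr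 A(x)\lambda,\omega\rangle\big)\operatorname{Re}\langle\lambda,\omega\rangle.$$ Then: 1. $A$ is strictly $L^\Phi$-dissipative if and only if there is $\kappa>0$ such that, for almost every $x\in(a,b)$, $P(x,\lambda,\omega)\ge\kappa|\lambda|^2$ for all $\lambda,\omega\in\mathbb C^m$ with $|\omega|=1$. 2. There is $\kappa>0$ such that $A-\kappa I\,\frac{d^2}{dx^2}$ is $L^\Phi$-dissipative if and only if $$\operatorname*{ess\,inf}_{x\in(a,b),\ |\lambda|=|\omega|=1}P(x,\lambda,\omega)>0,$$ where the essential infimum is taken with respect to the product of Lebesgue measure on $(a,b)$ and the surface measures on the two unit spheres of $\mathbb C^m$. -/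

import Mathlib

open MeasureTheory Filter Topology Set

noncomputable section

/-- Complex `m`-vectors with the Euclidean norm. -/
abbrev CVec (m : ℕ) : Type := EuclideanSpace ℂ (Fin m)

/-- `⟨M ξ, η⟩ = ∑ᵢ (M ξ)ᵢ * conj ηᵢ`. Mathlib's inner product is conjugate-linear in its first
argument, hence the order of the arguments. -/
def sesq {m : ℕ} (M : Matrix (Fin m) (Fin m) ℂ) (ξ η : CVec m) : ℂ :=
  inner ℂ η (Matrix.toEuclideanLin M ξ)

/-- The conditions (i)-(vi) on the positive function `φ : (0, ∞) → (0, ∞)`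
(the values of `φ` outside `(0, ∞)` are irrelevant). -/
structure PhiAdmissible (φ : ℝ → ℝ) : Prop where
  pos : ∀ s, 0 < s → 0 < φ s
  contDiffOn : ContDiffOn ℝ 1 φ (Ioi 0)
  deriv_pos : ∀ s, 0 < s → 0 < deriv (fun t => t * φ t) s
  range_eq : (fun s => s * φ s) '' Ioi 0 = Ioi 0
  growth : ∃ C₁ C₂ r s₀ s₁ : ℝ, 0 < C₁ ∧ 0 < C₂ ∧ -1 < r ∧ 0 < s₀ ∧ s₀ < s₁ ∧
    (∀ s ∈ Ioo 0 s₀, C₁ * s ^ r ≤ deriv (fun t => t * φ t) s ∧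
      deriv (fun t => t * φ t) s ≤ C₂ * s ^ r) ∧
    (r = 0 → (∃ φ₀ : ℝ, 0 < φ₀ ∧ Tendsto φ (𝓝[>] 0) (𝓝 φ₀)) ∧
      Tendsto (fun s => s * deriv φ s) (𝓝[>] 0) (𝓝 0)) ∧
    ((∀ s, s₁ ≤ s → 0 ≤ deriv φ s) ∨ (∀ s, s₁ ≤ s → deriv φ s ≤ 0))
  monotone : MonotoneOn (fun s => |s * deriv φ s / φ s|) (Ioi 0)

/-- The function `Λ` on `(0, ∞)`, determined by
`Λ (s √φ(s)) = - s φ'(s) / (s φ'(s) + 2 φ(s))` for `s > 0`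
(see `capLambda_apply`): at `t` it is the right-hand side taken at the unique
`s > 0` with `s √φ(s) = t`. -/
def capLambda (φ : ℝ → ℝ) (t : ℝ) : ℝ :=
  (fun s => -(s * deriv φ s) / (s * deriv φ s + 2 * φ s))
    (Function.invFunOn (fun s => s * √(φ s)) (Ioi 0) t)

theorem PhiAdmissible.deriv_mul {φ : ℝ → ℝ} (hφ : PhiAdmissible φ) {s : ℝ} (hs : 0 < s) :
    0 < φ s + s * deriv φ s := by
  have hd : DifferentiableAt ℝ φ s :=
    (hφ.contDiffOn.differentiableOn one_ne_zero).differentiableAt (Ioi_mem_nhds hs)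
  have h := ((hasDerivAt_id s).mul hd.hasDerivAt).deriv
  have h2 := hφ.deriv_pos s hs
  have h3 : deriv (fun t => t * φ t) s = 1 * φ s + s * deriv φ s := h
  linarith

theorem PhiAdmissible.strictMonoOn_mul {φ : ℝ → ℝ} (hφ : PhiAdmissible φ) :
    StrictMonoOn (fun s => s * φ s) (Ioi 0) := by
  apply strictMonoOn_of_deriv_pos (convex_Ioi 0)
  · exact continuousOn_id.mul hφ.contDiffOn.continuousOn
  · intro x hx
    rw [interior_Ioi] at hx
    exact hφ.deriv_pos x hx

theorem PhiAdmissible.strictMonoOn_mul_sqrt {φ : ℝ → ℝ} (hφ : PhiAdmissible φ) :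
    StrictMonoOn (fun s => s * √(φ s)) (Ioi 0) := by
  intro s hs t ht hst
  have hs0 : (0 : ℝ) < s := hs
  have ht0 : (0 : ℝ) < t := ht
  have h := hφ.strictMonoOn_mul hs ht hst
  simp only at h ⊢
  have h1 := Real.sq_sqrt (hφ.pos s hs0).le
  have h2 := Real.sq_sqrt (hφ.pos t ht0).le
  have h3 : 0 < s * φ s := mul_pos hs0 (hφ.pos s hs0)
  apply lt_of_pow_lt_pow_left₀ 2 (by positivity)
  rw [mul_pow, mul_pow, h1, h2]
  nlinarith

/-- `s √φ(s)` maps `(0, ∞)` onto `(0, ∞)`. -/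
theorem PhiAdmissible.surjOn_mul_sqrt {φ : ℝ → ℝ} (hφ : PhiAdmissible φ) :
    SurjOn (fun s => s * √(φ s)) (Ioi 0) (Ioi 0) := by
  intro t ht
  have ht0 : (0 : ℝ) < t := ht
  have h1 : t ^ 2 ∈ (fun s => s * φ s) '' Ioi 0 := by
    rw [hφ.range_eq]; exact pow_pos ht0 2
  obtain ⟨c, hc, hct⟩ := h1
  have hc0 : (0 : ℝ) < c := hc
  simp only at hct
  have hsub : uIcc c 1 ⊆ Ioi (0 : ℝ) := fun y hy =>
    lt_of_lt_of_le (lt_min hc0 one_pos) hy.1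
  have hcont : ContinuousOn (fun s => s * (s * φ s)) (uIcc c 1) :=
    (continuousOn_id.mul (continuousOn_id.mul hφ.contDiffOn.continuousOn)).mono hsub
  have hmem : t ^ 2 ∈ uIcc (c * (c * φ c)) (1 * (1 * φ 1)) := by
    rw [hct, mem_uIcc]
    have hm := hφ.strictMonoOn_mul.monotoneOn
    have ht2 : 0 < t ^ 2 := pow_pos ht0 2
    rcases le_total c 1 with h | h
    · left
      have := hm hc (mem_Ioi.2 one_pos : (1 : ℝ) ∈ Ioi 0) h
      simp only [hct] at this
      exact ⟨by nlinarith, by linarith⟩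
    · right
      have := hm (mem_Ioi.2 one_pos : (1 : ℝ) ∈ Ioi 0) hc h
      simp only [hct] at this
      exact ⟨by linarith, by nlinarith⟩
  obtain ⟨s, hs, hst⟩ := intermediate_value_uIcc hcont hmem
  have hs0 : (0 : ℝ) < s := hsub hs
  refine ⟨s, hs0, ?_⟩
  simp only at hst ⊢
  have h2 := Real.sq_sqrt (hφ.pos s hs0).le
  apply (pow_left_inj₀ (by positivity) ht0.le two_ne_zero).1
  rw [mul_pow, h2, ← hst]
  ring

theorem capLambda_apply {φ : ℝ → ℝ} (hφ : PhiAdmissible φ) {s : ℝ} (hs : 0 < s) :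
    capLambda φ (s * √(φ s)) = -(s * deriv φ s) / (s * deriv φ s + 2 * φ s) := by
  have h : Function.invFunOn (fun s => s * √(φ s)) (Ioi 0) (s * √(φ s)) = s :=
    hφ.strictMonoOn_mul_sqrt.injOn.leftInvOn_invFunOn hs
  simp only [capLambda, h]

/-- `Λ_∞ = lim_{t → ∞} Λ(t)` (the limit exists: see `tendsto_capLambda`). -/
def capLambdaInf (φ : ℝ → ℝ) : ℝ := limUnder atTop (capLambda φ)

theorem tendsto_capLambda {φ : ℝ → ℝ} (hφ : PhiAdmissible φ) :
    Tendsto (capLambda φ) atTop (𝓝 (capLambdaInf φ)) := by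
  suffices h : ∃ l, Tendsto (capLambda φ) atTop (𝓝 l) from tendsto_nhds_limUnder h
  obtain ⟨_, _, _, s₀, s₁, _, _, _, h0, h01, _, _, hv⟩ := hφ.growth
  have hs1 : 0 < s₁ := h0.trans h01
  set F : ℝ → ℝ := fun s => -(s * deriv φ s) / (s * deriv φ s + 2 * φ s) with hF
  have hden : ∀ s, 0 < s → 0 < s * deriv φ s + 2 * φ s := fun s hs => by
    have := hφ.deriv_mul hs
    have := hφ.pos s hs
    linarith
  have hpos : ∀ y, 0 < max y s₁ := fun y => lt_of_lt_of_le hs1 (le_max_right _ _)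
  have hF1 : ∀ s, 0 < s → -1 ≤ F s ∧ F s ≤ 1 := fun s hs => by
    have h1 := hφ.deriv_mul hs
    have h2 := hφ.pos s hs
    rw [hF]
    constructor
    · rw [le_div_iff₀ (hden s hs)]; linarith
    · rw [div_le_iff₀ (hden s hs)]; linarith
  have key : ∀ s t, 0 < s → 0 < t → s * deriv φ s / φ s ≤ t * deriv φ t / φ t → F t ≤ F s := by
    intro s t hs ht h
    rw [div_le_div_iff₀ (hφ.pos s hs) (hφ.pos t ht)] at h
    rw [hF]
    simp only
    rw [div_le_div_iff₀ (hden t ht) (hden s hs)]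
    nlinarith
  have hlim : ∃ l, Tendsto (fun s => F (max s s₁)) atTop (𝓝 l) := by
    rcases hv with hv | hv
    · have hanti : Antitone (fun s => F (max s s₁)) := by
        intro y z hyz
        apply key _ _ (hpos y) (hpos z)
        have := hφ.monotone (hpos y) (hpos z) (max_le_max_right s₁ hyz)
        simp only at this
        rwa [abs_of_nonneg, abs_of_nonneg] at this
        · exact div_nonneg (mul_nonneg (hpos z).le (hv _ (le_max_right _ _)))
            (hφ.pos _ (hpos z)).le
        · exact div_nonneg (mul_nonneg (hpos y).le (hv _ (le_max_right _ _)))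
            (hφ.pos _ (hpos y)).le
      exact ⟨_, tendsto_atTop_ciInf hanti ⟨-1, by
        rintro _ ⟨y, rfl⟩; exact (hF1 _ (hpos y)).1⟩⟩
    · have hmono : Monotone (fun s => F (max s s₁)) := by
        intro y z hyz
        apply key _ _ (hpos z) (hpos y)
        have := hφ.monotone (hpos y) (hpos z) (max_le_max_right s₁ hyz)
        simp only at this
        rw [abs_of_nonpos, abs_of_nonpos] at this
        · linarith
        · exact div_nonpos_of_nonpos_of_nonneg
            (mul_nonpos_of_nonneg_of_nonpos (hpos z).le (hv _ (le_max_right _ _)))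
            (hφ.pos _ (hpos z)).le
        · exact div_nonpos_of_nonpos_of_nonneg
            (mul_nonpos_of_nonneg_of_nonpos (hpos y).le (hv _ (le_max_right _ _)))
            (hφ.pos _ (hpos y)).le
      exact ⟨_, tendsto_atTop_ciSup hmono ⟨1, by
        rintro _ ⟨y, rfl⟩; exact (hF1 _ (hpos y)).2⟩⟩
  obtain ⟨l, hl⟩ := hlim
  have hl' : Tendsto F atTop (𝓝 l) := hl.congr' (by
    filter_upwards [eventually_ge_atTop s₁] with y hy
    rw [max_eq_left hy])
  have hg : Tendsto (Function.invFunOn (fun s => s * √(φ s)) (Ioi 0)) atTop atTop := by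
    rw [tendsto_atTop]
    intro N
    have hN : 0 < max N 1 := lt_of_lt_of_le one_pos (le_max_right _ _)
    filter_upwards [eventually_gt_atTop 0,
      eventually_gt_atTop (max N 1 * √(φ (max N 1)))] with t ht0 ht
    have h1 := Function.invFunOn_pos (hφ.surjOn_mul_sqrt ht0)
    have h2 := h1.2
    rw [← h2] at ht
    exact (le_max_left _ _).trans (hφ.strictMonoOn_mul_sqrt.lt_iff_lt hN h1.1 |>.1 ht).le
  exact ⟨l, hl'.comp hg⟩

/-- The open interval `(a, b) ⊆ ℝ`, bounded or unbounded. -/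
def openInterval (a b : EReal) : Set ℝ := {x | a < (x : EReal) ∧ (x : EReal) < b}

/-- `C¹` functions with compact support in the open set `I`. -/
def IsC1c {m : ℕ} (I : Set ℝ) (u : ℝ → CVec m) : Prop :=
  ContDiff ℝ 1 u ∧ HasCompactSupport u ∧ tsupport u ⊆ I

/-- `L^Φ`-dissipativity of the operator `u ↦ (𝒜 u')'` on `I`. -/
def IsPhiDissipative {m : ℕ} (φ : ℝ → ℝ) (I : Set ℝ)
    (𝒜 : ℝ → Matrix (Fin m) (Fin m) ℂ) : Prop :=
  ∀ u : ℝ → CVec m, IsC1c I u → IsC1c I (fun x => φ ‖u x‖ • u x) →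
    0 ≤ (∫ x in I, sesq (𝒜 x) (deriv u x) (deriv (fun y => φ ‖u y‖ • u y) x)).re

/-- Strict `L^Φ`-dissipativity of the operator `u ↦ (𝒜 u')'` on `I`. -/
def IsStrictPhiDissipative {m : ℕ} (φ : ℝ → ℝ) (I : Set ℝ)
    (𝒜 : ℝ → Matrix (Fin m) (Fin m) ℂ) : Prop :=
  ∃ κ : ℝ, 0 < κ ∧ ∀ u : ℝ → CVec m, IsC1c I u → IsC1c I (fun x => φ ‖u x‖ • u x) →
    κ * (∫ x in I, ‖deriv (fun y => √(φ ‖u y‖) • u y) x‖ ^ 2) ≤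
      (∫ x in I, sesq (𝒜 x) (deriv u x) (deriv (fun y => φ ‖u y‖ • u y) x)).re

/-- `P(x, ξ, ω)`, as a function of the matrix `M = 𝒜(x)` and of `L = Λ_∞`. -/
def formP {m : ℕ} (L : ℝ) (M : Matrix (Fin m) (Fin m) ℂ) (ξ ω : CVec m) : ℝ :=
  (sesq M ξ ξ).re - L ^ 2 * (sesq M ω ω).re * (inner ℂ ω ξ).re ^ 2
    + L * (sesq M ω ξ - sesq M ξ ω).re * (inner ℂ ω ξ).re

/-- The essential infimum of `P(x, ξ, ω)` over `x ∈ I`, `|ξ| = |ω| = 1`, with respect to the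
product of Lebesgue measure on `I` and of the surface measures on the two unit spheres. -/
def essInfP {m : ℕ} (L : ℝ) (I : Set ℝ) (𝒜 : ℝ → Matrix (Fin m) (Fin m) ℂ) : EReal :=
  essInf
    (fun z : ℝ × (Metric.sphere (0 : CVec m) 1 × Metric.sphere (0 : CVec m) 1) =>
      ((formP L (𝒜 z.1) z.2.1 z.2.2 : ℝ) : EReal))
    ((volume.restrict I).prod
      ((volume : Measure (CVec m)).toSphere.prod (volume : Measure (CVec m)).toSphere))

end

/-!
Write `R` for the radial map `y ↦ φ(|y|) y`. Its differential at `y ≠ 0` is, up to the factor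
`φ(|y|)`, the stretching by the elasticity `q = 1 + s φ'(s) / φ(s)`, `s = |y|`, in the direction of
`y`. So where `u ≠ 0` the integrand `Re ⟨𝒜 u', (R u)'⟩` is nonnegative as soon as `Re ⟨𝒜 ·, ·⟩` is
nonnegative on all pairs `(v, w)` with `w` a stretching of `v` by `q`; and `u' = 0` almost
everywhere on the zero set of `u`.

In the variable `q` this nonnegativity is a discriminant inequality, convex in `q` and invariant
under `q ↦ 1 / q`, so its validity for one `p` implies it for all `q` between `1 / p` and `p`. By
the monotonicity condition on `φ` the elasticity stays between `1` and its limit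
`p = (1 - Λ_∞) / (1 + Λ_∞)`, which makes the condition at `q = p` sufficient. A change of variables
turns the condition at `q = p` into `P ≥ 0`.

For the necessity one tests with curves that are locally `y + ρ(x) l`, where
`ρ = N⁻¹ ζ(x) sin (N² x + α)`. As `N → ∞` the terms of size `N²` dominate; adding the phases
`α = 0` and `α = π / 2` makes `sin² + cos² = 1` appear, so that `∫ ζ² Re ⟨𝒜 l, DR(y) l⟩ ≥ 0`
follows, and then the pointwise inequality by Lebesgue differentiation.

The strict versions are the same statements for `𝒜 - κ`, because `⟨u', (R u)'⟩` and
`|(√φ(|u|) u)'|²` bound each other up to constants.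
-/

section StretchedForms

open scoped RealInnerProductSpace

lemma sq_mul_add_le_of_mem_uIcc {p q b c k : ℝ} (hp : 0 < p) (hbc : (p * b + c) ^ 2 ≤ p * k)
    (hcb : (b + p * c) ^ 2 ≤ p * k) (hq : q ∈ uIcc p⁻¹ p) : (q * b + c) ^ 2 ≤ q * k := by
  -- `(q b + c)² / q = b² q + c² / q + 2 b c` is convex in `q > 0`.
  have hpos : ∀ t ∈ uIcc p⁻¹ p, 0 < t := fun t ht => (lt_min (inv_pos.2 hp) hp).trans_le ht.1
  have hconv : ConvexOn ℝ (Ioi 0) fun t : ℝ => b ^ 2 * t + c ^ 2 * t ^ (-1 : ℤ) :=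
    ((convexOn_id (convex_Ioi 0)).smul (sq_nonneg b)).add
      ((convexOn_zpow (-1)).smul (sq_nonneg c))
  have hmax := hconv.le_max_of_mem_segment (mem_Ioi.2 (inv_pos.2 hp)) (mem_Ioi.2 hp)
    (segment_eq_uIcc p⁻¹ p ▸ hq)
  simp only [zpow_neg_one, inv_inv] at hmax
  have hends : max (b ^ 2 * p⁻¹ + c ^ 2 * p) (b ^ 2 * p + c ^ 2 * p⁻¹) ≤ k - 2 * b * c := by
    refine max_le ?_ ?_ <;> refine le_of_mul_le_mul_left ?_ hp
    · have : p * (b ^ 2 * p⁻¹ + c ^ 2 * p) = b ^ 2 + (p * c) ^ 2 := by field_simp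
      linarith
    · have : p * (b ^ 2 * p + c ^ 2 * p⁻¹) = (p * b) ^ 2 + c ^ 2 := by field_simp
      linarith
  have hscaled := mul_le_mul_of_nonneg_left (hmax.trans hends) (hpos q hq).le
  have hcancel : q * (b ^ 2 * q + c ^ 2 * q⁻¹) = (q * b) ^ 2 + c ^ 2 := by
    field_simp [(hpos q hq).ne']
  linarith

lemma uIcc_one_subset_uIcc_inv {p : ℝ} (hp : 0 < p) : uIcc 1 p ⊆ uIcc p⁻¹ p := by
  refine uIcc_subset_uIcc_right ?_
  rcases le_total p 1 with h | h
  · exact mem_uIcc.2 (Or.inr ⟨h, (one_le_inv₀ hp).2 h⟩)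
  · exact mem_uIcc.2 (Or.inl ⟨inv_le_one_of_one_le₀ h, h⟩)

variable {E : Type*} [NormedAddCommGroup E] [InnerProductSpace ℝ E]

/-- A bilinear form `B` is nonnegative under stretching by `p` if it is nonnegative on every pair
`(v, w)` in which `w` is obtained from `v` by stretching one direction by the factor `p` and
keeping the orthogonal directions. -/
def StretchNonneg (p : ℝ) (B : E →L[ℝ] E →L[ℝ] ℝ) : Prop :=
  ∀ ξ η : E, ⟪ξ, η⟫ = 0 → 0 ≤ B (ξ + η) (p • ξ + η)

/-- The inner product as a real bilinear form; `innerSL ℝ` has the same values, but its type is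
that of a conjugate-linear map. -/
noncomputable def innerForm (E : Type*) [NormedAddCommGroup E] [InnerProductSpace ℝ E] :
    E →L[ℝ] E →L[ℝ] ℝ :=
  innerSL ℝ

lemma innerForm_apply (ξ η : E) : innerForm E ξ η = ⟪ξ, η⟫ := rfl

variable {p : ℝ} {B : E →L[ℝ] E →L[ℝ] ℝ}

lemma stretchNonneg_iff_sq_le (hp : 0 < p) :
    StretchNonneg p B ↔ ∀ ξ η : E, ⟪ξ, η⟫ = 0 →
      0 ≤ B ξ ξ ∧ (B ξ η + p * B η ξ) ^ 2 ≤ p * (4 * B ξ ξ * B η η) := by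
  refine ⟨fun h ξ η hξη => ⟨?_, ?_⟩, fun h ξ η hξη => ?_⟩
  · simpa using h 0 ξ (inner_zero_left _)
  · have hquad : ∀ t : ℝ, 0 ≤ p * B ξ ξ * (t * t) + (B ξ η + p * B η ξ) * t + B η η := by
      intro t
      have := h (t • ξ) η (by rw [inner_smul_left, hξη, mul_zero])
      simp only [map_add, map_smul, add_apply, smul_apply,
        smul_eq_mul] at this
      linarith
    have := discrim_le_zero hquad
    rw [discrim] at this
    linarith
  · have hηη := (h η ξ ((real_inner_comm _ _).trans hξη)).1
    obtain ⟨hξξ, hsq⟩ := h ξ η hξη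
    have hmid : |B ξ η + p * B η ξ| ≤ p * B ξ ξ + B η η :=
      abs_le_of_sq_le_sq (by nlinarith [sq_nonneg (p * B ξ ξ - B η η)]) (by positivity)
    simp only [map_add, map_smul, add_apply, smul_eq_mul]
    linarith [(abs_le.1 hmid).1]

lemma StretchNonneg.of_mem_uIcc {q : ℝ} (h : StretchNonneg p B) (hp : 0 < p)
    (hq : q ∈ uIcc p⁻¹ p) : StretchNonneg q B := by
  have hq0 : 0 < q := (lt_min (inv_pos.2 hp) hp).trans_le hq.1
  rw [stretchNonneg_iff_sq_le hp] at h
  refine (stretchNonneg_iff_sq_le hq0).2 fun ξ η hξη => ⟨(h ξ η hξη).1, ?_⟩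
  have hswap := (h η ξ ((real_inner_comm _ _).trans hξη)).2
  rw [add_comm (B ξ η)]
  refine sq_mul_add_le_of_mem_uIcc hp ?_ ?_ hq
  · linarith [(h ξ η hξη).2]
  · linarith

/-- The form of the algebraic ellipticity condition: `B` evaluated at the images of `ξ` under the
two opposite stretchings `1 ± L` in the direction of the unit vector `ω`. -/
noncomputable def shearForm (L : ℝ) (B : E →L[ℝ] E →L[ℝ] ℝ) (ξ ω : E) : ℝ :=
  B (ξ + (L * ⟪ω, ξ⟫) • ω) (ξ - (L * ⟪ω, ξ⟫) • ω)

variable {L : ℝ}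

lemma one_sub_div_one_add_pos_iff : 0 < (1 - L) / (1 + L) ↔ L ^ 2 < 1 := by
  rw [div_pos_iff, sq_lt_one_iff_abs_lt_one, abs_lt]
  constructor
  · rintro (⟨h₁, h₂⟩ | ⟨h₁, h₂⟩)
    · constructor <;> linarith
    · linarith
  · rintro ⟨h₁, h₂⟩
    exact Or.inl ⟨by linarith, by linarith⟩

lemma one_add_pos_of_sq_lt_one (hL : L ^ 2 < 1) : 0 < 1 + L := by
  linarith [(abs_lt.1 ((sq_lt_one_iff_abs_lt_one L).1 hL)).1]

lemma shearForm_eq_stretch (hL : 1 + L ≠ 0) (ω ζ : E) (hω : ‖ω‖ = 1) (hωζ : ⟪ω, ζ⟫ = 0) (c : ℝ) :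
    shearForm L B (c • ω + ζ) ω =
      B (((1 + L) * c) • ω + ζ) (((1 - L) / (1 + L)) • ((1 + L) * c) • ω + ζ) := by
  have hc : ⟪ω, c • ω + ζ⟫ = c := by
    rw [inner_add_right, inner_smul_right, real_inner_self_eq_norm_sq, hω, hωζ]; ring
  rw [shearForm, hc, smul_smul, ← mul_assoc, div_mul_cancel₀ _ hL]
  congr 1
  · congr 1; module
  · module

lemma stretchNonneg_iff_shearForm_nonneg (hL : L ^ 2 < 1) :
    StretchNonneg ((1 - L) / (1 + L)) B ↔ ∀ ξ ω : E, ‖ω‖ = 1 → 0 ≤ shearForm L B ξ ω := by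
  have hL₁ := one_add_pos_of_sq_lt_one hL
  refine ⟨fun h ξ ω hω => ?_, fun h ξ η hξη => ?_⟩
  · have horth : ⟪ω, ξ - ⟪ω, ξ⟫ • ω⟫ = 0 := by
      rw [inner_sub_right, inner_smul_right, real_inner_self_eq_norm_sq, hω]; ring
    rw [← add_sub_cancel (⟪ω, ξ⟫ • ω) ξ, shearForm_eq_stretch hL₁.ne' ω _ hω horth]
    exact h _ _ (by rw [inner_smul_left, horth, mul_zero])
  · rcases eq_or_ne ξ 0 with rfl | hξ
    · rcases eq_or_ne η 0 with rfl | hη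
      · simp
      have hunit : ‖‖η‖⁻¹ • η‖ = 1 := norm_smul_inv_norm (𝕜 := ℝ) hη
      have hdiag : shearForm L B (‖η‖ • (‖η‖⁻¹ • η) + 0) (‖η‖⁻¹ • η) = (1 - L ^ 2) * B η η := by
        rw [shearForm_eq_stretch hL₁.ne' _ _ hunit (inner_zero_right _)]
        simp only [add_zero, smul_smul, map_smul, smul_apply, smul_eq_mul]
        have := norm_ne_zero_iff.2 hη
        field_simp
        ring
      have hnonneg := h (‖η‖ • (‖η‖⁻¹ • η) + 0) _ hunit
      rw [hdiag] at hnonneg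
      simpa using nonneg_of_mul_nonneg_right hnonneg (by linarith)
    · have hunit : ‖‖ξ‖⁻¹ • ξ‖ = 1 := norm_smul_inv_norm (𝕜 := ℝ) hξ
      have hstretch : ((1 + L) * (‖ξ‖ / (1 + L))) • (‖ξ‖⁻¹ • ξ) = ξ := by
        rw [mul_div_cancel₀ _ hL₁.ne', smul_inv_smul₀ (norm_ne_zero_iff.2 hξ)]
      have hnonneg := h ((‖ξ‖ / (1 + L)) • (‖ξ‖⁻¹ • ξ) + η) _ hunit
      rwa [shearForm_eq_stretch hL₁.ne' _ _ hunit
        (by rw [inner_smul_left, hξη, mul_zero]), hstretch] at hnonneg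

lemma shearForm_sub_smul_innerForm (κ : ℝ) (ξ ω : E) (hω : ‖ω‖ = 1) :
    shearForm L (B - κ • innerForm E) ξ ω =
      shearForm L B ξ ω - κ * (‖ξ‖ ^ 2 - L ^ 2 * ⟪ω, ξ⟫ ^ 2) := by
  simp only [shearForm, sub_apply, smul_apply]
  congr 1
  simp only [smul_eq_mul, innerForm_apply, inner_add_left, inner_sub_right, inner_smul_left,
    inner_smul_right, real_inner_self_eq_norm_sq, hω, real_inner_comm ω ξ, conj_trivial]
  ring

lemma StretchNonneg.mul_norm_sq_le_shearForm {κ : ℝ} (hL : L ^ 2 < 1) (hκ : 0 ≤ κ)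
    (h : StretchNonneg ((1 - L) / (1 + L)) (B - κ • innerForm E)) {ξ ω : E} (hω : ‖ω‖ = 1) :
    κ * (1 - L ^ 2) * ‖ξ‖ ^ 2 ≤ shearForm L B ξ ω := by
  have hnonneg := (stretchNonneg_iff_shearForm_nonneg hL).1 h ξ ω hω
  rw [shearForm_sub_smul_innerForm κ ξ ω hω] at hnonneg
  have hcs : ⟪ω, ξ⟫ ^ 2 ≤ ‖ξ‖ ^ 2 :=
    sq_le_sq.2 (by simpa [hω] using abs_real_inner_le_norm ω ξ)
  nlinarith [mul_le_mul_of_nonneg_left hcs (mul_nonneg hκ (sq_nonneg L))]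

lemma StretchNonneg.of_mul_norm_sq_le_shearForm {κ : ℝ} (hL : L ^ 2 < 1) (hκ : 0 ≤ κ)
    (h : ∀ ξ ω : E, ‖ω‖ = 1 → κ * ‖ξ‖ ^ 2 ≤ shearForm L B ξ ω) :
    StretchNonneg ((1 - L) / (1 + L)) (B - κ • innerForm E) := by
  refine (stretchNonneg_iff_shearForm_nonneg hL).2 fun ξ ω hω => ?_
  rw [shearForm_sub_smul_innerForm κ ξ ω hω]
  nlinarith [h ξ ω hω, mul_nonneg hκ (mul_nonneg (sq_nonneg L) (sq_nonneg ⟪ω, ξ⟫))]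

end StretchedForms

section RadialMaps

open scoped RealInnerProductSpace

variable {E : Type*} [NormedAddCommGroup E] [InnerProductSpace ℝ E]

/-- The radial map `y ↦ ψ(|y|) y`. -/
def radialMap (ψ : ℝ → ℝ) (y : E) : E := ψ ‖y‖ • y

/-- The elasticity (logarithmic derivative) `s (s ψ(s))' / (s ψ(s))` of `s ↦ s ψ(s)`, written
`1 + s ψ'(s) / ψ(s)`: the factor by which the differential of `radialMap ψ` stretches the radial
direction relative to the tangential ones. -/
noncomputable def elasticity (ψ : ℝ → ℝ) (s : ℝ) : ℝ := 1 + s * deriv ψ s / ψ s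

@[simp]
lemma radialMap_zero (ψ : ℝ → ℝ) : radialMap ψ (0 : E) = 0 := smul_zero _

lemma hasFDerivAt_norm_of_ne_zero {y : E} (hy : y ≠ 0) :
    HasFDerivAt (fun z : E => ‖z‖) (‖y‖⁻¹ • innerSL ℝ y) y := by
  have h := (hasStrictFDerivAt_norm_sq y).hasFDerivAt.sqrt (pow_ne_zero 2 (norm_ne_zero_iff.2 hy))
  simp only [Real.sqrt_sq (norm_nonneg _)] at h
  convert h using 1
  ext l
  have := norm_ne_zero_iff.2 hy
  simp only [smul_apply, innerSL_apply_apply, smul_eq_mul, nsmul_eq_mul, Nat.cast_ofNat]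
  field_simp

variable {ψ : ℝ → ℝ} {y : E}

lemma fderiv_radialMap_apply (hy : y ≠ 0) (hψ : DifferentiableAt ℝ ψ ‖y‖) (l : E) :
    fderiv ℝ (radialMap ψ) y l = ψ ‖y‖ • l + (deriv ψ ‖y‖ * (‖y‖⁻¹ * ⟪y, l⟫)) • y := by
  have h := (hψ.hasDerivAt.comp_hasFDerivAt y (hasFDerivAt_norm_of_ne_zero hy)).smul
    (hasFDerivAt_id y)
  exact DFunLike.congr_fun h.fderiv l

lemma fderiv_radialMap_smul_add (hy : y ≠ 0) (hψ : DifferentiableAt ℝ ψ ‖y‖) (hψ₀ : ψ ‖y‖ ≠ 0)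
    (c : ℝ) {η : E} (hη : ⟪y, η⟫ = 0) :
    fderiv ℝ (radialMap ψ) y (c • y + η) = ψ ‖y‖ • (elasticity ψ ‖y‖ • c • y + η) := by
  have hnorm := norm_ne_zero_iff.2 hy
  rw [fderiv_radialMap_apply hy hψ, inner_add_right, hη, inner_smul_right,
    real_inner_self_eq_norm_sq, elasticity]
  match_scalars <;> field_simp
  ring

lemma exists_smul_add_orthogonal (y l : E) : ∃ (c : ℝ) (η : E), ⟪y, η⟫ = 0 ∧ l = c • y + η := by
  have horth := (ℝ ∙ y).sub_starProjection_mem_orthogonal l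
  rw [Submodule.starProjection_singleton, Submodule.mem_orthogonal_singleton_iff_inner_right]
    at horth
  exact ⟨_, _, horth, (add_sub_cancel _ _).symm⟩

lemma contDiffAt_radialMap (hψ : ContDiffOn ℝ 1 ψ (Ioi 0)) (hy : y ≠ 0) :
    ContDiffAt ℝ 1 (radialMap ψ) y :=
  ((hψ.contDiffAt (Ioi_mem_nhds (norm_pos_iff.2 hy))).comp y (contDiffAt_norm ℝ hy)).smul
    contDiffAt_id

lemma continuousOn_fderiv_radialMap (hψ : ContDiffOn ℝ 1 ψ (Ioi 0)) :
    ContinuousOn (fderiv ℝ (radialMap ψ : E → E)) {0}ᶜ :=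
  fun _ hy => ((contDiffAt_radialMap hψ hy).continuousAt_fderiv one_ne_zero).continuousWithinAt

lemma elasticity_sqrt {s : ℝ} (hψ : DifferentiableAt ℝ ψ s) (hpos : 0 < ψ s) :
    elasticity (fun t => √(ψ t)) s = (1 + elasticity ψ s) / 2 := by
  rw [elasticity, elasticity, (hψ.hasDerivAt.sqrt hpos.ne').deriv]
  have hsq : √(ψ s) ^ 2 = ψ s := Real.sq_sqrt hpos.le
  have := (Real.sqrt_pos.2 hpos).ne'
  field_simp
  rw [hsq]
  ring

variable {B : E →L[ℝ] E →L[ℝ] ℝ}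

lemma StretchNonneg.apply_fderiv_radialMap_nonneg (hy : y ≠ 0) (hψ : DifferentiableAt ℝ ψ ‖y‖)
    (hpos : 0 < ψ ‖y‖) (h : StretchNonneg (elasticity ψ ‖y‖) B) (l : E) :
    0 ≤ B l (fderiv ℝ (radialMap ψ) y l) := by
  obtain ⟨c, η, hη, rfl⟩ := exists_smul_add_orthogonal y l
  rw [fderiv_radialMap_smul_add hy hψ hpos.ne' c hη, map_smul]
  exact mul_nonneg hpos.le (h (c • y) η (by rw [inner_smul_left, hη, mul_zero]))

lemma stretchNonneg_of_apply_fderiv_radialMap_nonneg {s : ℝ} (hs : 0 < s)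
    (hψ : DifferentiableAt ℝ ψ s) (hpos : 0 < ψ s) (hel : 0 < elasticity ψ s)
    (h : ∀ y : E, y ≠ 0 → ∀ l, 0 ≤ B l (fderiv ℝ (radialMap ψ) y l)) :
    StretchNonneg (elasticity ψ s) B := by
  have hstretch : ∀ ξ η : E, ξ ≠ 0 → ⟪ξ, η⟫ = 0 → 0 ≤ B (ξ + η) (elasticity ψ s • ξ + η) := by
    intro ξ η hξ hξη
    have hξ' := norm_ne_zero_iff.2 hξ
    have hnorm : ‖(s / ‖ξ‖) • ξ‖ = s := by
      rw [norm_smul, Real.norm_eq_abs, abs_div, abs_norm, div_mul_cancel₀ _ hξ', abs_of_pos hs]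
    have hsmul : (‖ξ‖ / s) • (s / ‖ξ‖) • ξ = ξ := by
      rw [smul_smul, div_mul_div_cancel₀ hs.ne', div_self hξ', one_smul]
    have hy : (s / ‖ξ‖) • ξ ≠ 0 := smul_ne_zero (div_ne_zero hs.ne' hξ') hξ
    have hfderiv := fderiv_radialMap_smul_add (ψ := ψ) hy (by rwa [hnorm])
      (by rw [hnorm]; exact hpos.ne') (‖ξ‖ / s) (η := η) (by rw [inner_smul_left, hξη, mul_zero])
    rw [hsmul, hnorm] at hfderiv
    have hnonneg := h _ hy (ξ + η)
    rw [hfderiv, map_smul] at hnonneg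
    exact nonneg_of_mul_nonneg_right hnonneg hpos
  intro ξ η hξη
  rcases eq_or_ne ξ 0 with rfl | hξ
  · rcases eq_or_ne η 0 with rfl | hη
    · simp
    · have := hstretch η 0 hη (inner_zero_right _)
      simp only [add_zero, map_smul, smul_eq_mul] at this
      simpa using nonneg_of_mul_nonneg_right this hel
  · exact hstretch ξ η hξ hξη

end RadialMaps

section RadialWeights

/-- The scalar weights of the theory: positive `C¹` functions on `(0, ∞)` whose elasticity tends
to `p > 0` at infinity and always lies between `1` and this limit. -/
structure IsRadialWeight (φ : ℝ → ℝ) (p : ℝ) : Prop where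
  pos : ∀ s, 0 < s → 0 < φ s
  contDiffOn : ContDiffOn ℝ 1 φ (Ioi 0)
  limit_pos : 0 < p
  elasticity_mem_uIcc : ∀ s, 0 < s → elasticity φ s ∈ uIcc 1 p
  tendsto_elasticity : Tendsto (elasticity φ) atTop (𝓝 p)

namespace IsRadialWeight

variable {φ : ℝ → ℝ} {p s : ℝ}

lemma differentiableAt (hφ : IsRadialWeight φ p) (hs : 0 < s) : DifferentiableAt ℝ φ s :=
  (hφ.contDiffOn.differentiableOn one_ne_zero).differentiableAt (Ioi_mem_nhds hs)

lemma min_one_le_elasticity (hφ : IsRadialWeight φ p) (hs : 0 < s) : min 1 p ≤ elasticity φ s :=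
  (hφ.elasticity_mem_uIcc s hs).1

lemma elasticity_pos (hφ : IsRadialWeight φ p) (hs : 0 < s) : 0 < elasticity φ s :=
  (lt_min one_pos hφ.limit_pos).trans_le (hφ.min_one_le_elasticity hs)

lemma hasDerivAt_rpow_mul (hφ : IsRadialWeight φ p) (hs : 0 < s) (c : ℝ) :
    HasDerivAt (fun t => t ^ c * φ t) (s ^ (c - 1) * φ s * (elasticity φ s + c - 1)) s := by
  refine ((Real.hasDerivAt_rpow_const (p := c) (Or.inl hs.ne')).mul
    (hφ.differentiableAt hs).hasDerivAt).congr_deriv ?_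
  have := (hφ.pos s hs).ne'
  rw [Real.rpow_sub_one hs.ne', elasticity]
  field_simp
  ring

lemma monotoneOn_rpow_mul (hφ : IsRadialWeight φ p) :
    MonotoneOn (fun s => s ^ (1 - min 1 p) * φ s) (Ioi 0) := by
  have hderiv := fun s (hs : 0 < s) => hφ.hasDerivAt_rpow_mul hs (1 - min 1 p)
  refine monotoneOn_of_deriv_nonneg (convex_Ioi 0)
    (fun s hs => (hderiv s hs).continuousAt.continuousWithinAt)
    (fun s hs => (hderiv s (interior_subset hs)).differentiableAt.differentiableWithinAt)
    fun s hs => ?_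
  have hs₀ : 0 < s := interior_subset hs
  rw [(hderiv s hs₀).deriv]
  have := hφ.pos s hs₀
  exact mul_nonneg (by positivity) (by linarith [hφ.min_one_le_elasticity hs₀])

lemma strictMonoOn_mul (hφ : IsRadialWeight φ p) : StrictMonoOn (fun s => s * φ s) (Ioi 0) := by
  have hderiv := fun s (hs : 0 < s) => hφ.hasDerivAt_rpow_mul hs 1
  simp only [Real.rpow_one, sub_self, Real.rpow_zero, one_mul, add_sub_cancel_right] at hderiv
  refine strictMonoOn_of_deriv_pos (convex_Ioi 0)
    (fun s hs => (hderiv s hs).continuousAt.continuousWithinAt) fun s hs => ?_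
  have hs₀ : 0 < s := interior_subset hs
  rw [(hderiv s hs₀).deriv]
  exact mul_pos (hφ.pos s hs₀) (hφ.elasticity_pos hs₀)

lemma tendsto_mul_nhdsGT_zero (hφ : IsRadialWeight φ p) :
    Tendsto (fun s => s * φ s) (𝓝[>] 0) (𝓝 0) := by
  have hc : 0 < min 1 p := lt_min one_pos hφ.limit_pos
  have hbound : ∀ s ∈ Ioc (0 : ℝ) 1, s * φ s ≤ s ^ min 1 p * φ 1 := by
    intro s hs
    have hmono := hφ.monotoneOn_rpow_mul hs.1 (mem_Ioi.2 one_pos) hs.2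
    have := mul_le_mul_of_nonneg_left hmono (Real.rpow_nonneg hs.1.le (min 1 p))
    simpa [← mul_assoc, ← Real.rpow_add hs.1] using this
  have hpow : Tendsto (fun s : ℝ => s ^ min 1 p * φ 1) (𝓝[>] 0) (𝓝 0) := by
    have := ((Real.continuousAt_rpow_const 0 _ (Or.inr hc.le)).mul_const (φ 1)).tendsto
    rw [Real.zero_rpow hc.ne', zero_mul] at this
    exact this.mono_left nhdsWithin_le_nhds
  refine squeeze_zero' ?_ ?_ hpow
  · filter_upwards [self_mem_nhdsWithin] with s hs using (mul_pos hs (hφ.pos s hs)).le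
  · filter_upwards [Ioc_mem_nhdsGT one_pos] with s hs using hbound s hs

end IsRadialWeight

end RadialWeights

section AdmissibleWeights

lemma mem_uIcc_zero_of_monotoneOn_abs {g : ℝ → ℝ} {l s : ℝ} (hcont : ContinuousOn g (Ioi 0))
    (hmono : MonotoneOn (fun s => |g s|) (Ioi 0)) (hlim : Tendsto g atTop (𝓝 l)) (hs : 0 < s) :
    g s ∈ uIcc 0 l := by
  wlog hl : 0 ≤ l generalizing g l
  · have hneg := this hcont.neg (by simpa only [Pi.neg_apply, abs_neg] using hmono) hlim.neg
      (by linarith)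
    rw [mem_uIcc, Pi.neg_apply] at hneg
    rw [mem_uIcc]
    rcases hneg with h | h
    · exact Or.inr ⟨by linarith, by linarith⟩
    · exact Or.inl ⟨by linarith, by linarith⟩
  have habs : ∀ t, s ≤ t → |g s| ≤ |g t| := fun t ht => hmono hs (hs.trans_le ht) ht
  have hle : |g s| ≤ l := by
    rw [← abs_of_nonneg hl]
    exact ge_of_tendsto hlim.abs (eventually_atTop.2 ⟨s, habs⟩)
  rw [uIcc_of_le hl]
  refine ⟨le_of_not_gt fun hneg => ?_, (le_abs_self _).trans hle⟩
  have hgs : 0 < |g s| := abs_pos.2 hneg.ne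
  -- `g` cannot vanish beyond `s`, so it keeps its sign there and stays away from its limit.
  have hstay : ∀ t, s ≤ t → g t ≤ g s := by
    intro t ht
    have htneg : g t < 0 := by
      by_contra! hge
      obtain ⟨z, hz, hz₀⟩ := intermediate_value_Icc ht
        (hcont.mono fun z hz => hs.trans_le hz.1) ⟨hneg.le, hge⟩
      have := habs z hz.1
      rw [hz₀, abs_zero] at this
      exact hgs.not_ge this
    have := habs t ht
    rw [abs_of_neg hneg, abs_of_neg htneg] at this
    linarith
  exact (hneg.trans_le hl).not_ge (le_of_tendsto hlim (eventually_atTop.2 ⟨s, hstay⟩))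

namespace PhiAdmissible

variable {φ : ℝ → ℝ} {s : ℝ}

lemma elasticity_pos (hφ : PhiAdmissible φ) (hs : 0 < s) : 0 < elasticity φ s := by
  have := hφ.pos s hs
  rw [elasticity, one_add_div this.ne']
  exact div_pos (hφ.deriv_mul hs) this

lemma tendsto_mul_sqrt_atTop (hφ : PhiAdmissible φ) :
    Tendsto (fun s => s * √(φ s)) atTop atTop := by
  refine tendsto_atTop.2 fun N => ?_
  obtain ⟨s, hs, hsN⟩ := hφ.surjOn_mul_sqrt (mem_Ioi.2 (lt_max_of_lt_right one_pos : 0 < max N 1))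
  filter_upwards [eventually_ge_atTop s] with t ht
  exact (le_max_left N 1).trans
    (hsN.symm.trans_le (hφ.strictMonoOn_mul_sqrt.monotoneOn hs (hs.trans_le ht) ht))

lemma capLambda_mul_sqrt (hφ : PhiAdmissible φ) (hs : 0 < s) :
    capLambda φ (s * √(φ s)) = (1 - elasticity φ s) / (1 + elasticity φ s) := by
  have h₁ := hφ.pos s hs
  have h₂ := hφ.deriv_mul hs
  rw [capLambda_apply hφ hs, elasticity]
  have h₃ : s * deriv φ s + 2 * φ s ≠ 0 := by linarith
  field_simp
  ring

lemma tendsto_elasticity (hφ : PhiAdmissible φ) (hΛ : capLambdaInf φ ^ 2 < 1) :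
    Tendsto (elasticity φ) atTop (𝓝 ((1 - capLambdaInf φ) / (1 + capLambdaInf φ))) := by
  have hlim := (tendsto_capLambda hφ).comp hφ.tendsto_mul_sqrt_atTop
  refine ((hlim.const_sub 1).div (hlim.const_add 1) (one_add_pos_of_sq_lt_one hΛ).ne').congr' ?_
  filter_upwards [eventually_gt_atTop 0] with s hs
  have := hφ.elasticity_pos hs
  simp only [Pi.div_apply, Function.comp_apply, hφ.capLambda_mul_sqrt hs]
  field_simp
  ring

lemma isRadialWeight (hφ : PhiAdmissible φ) (hΛ : capLambdaInf φ ^ 2 < 1) :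
    IsRadialWeight φ ((1 - capLambdaInf φ) / (1 + capLambdaInf φ)) where
  pos := hφ.pos
  contDiffOn := hφ.contDiffOn
  limit_pos := one_sub_div_one_add_pos_iff.2 hΛ
  tendsto_elasticity := hφ.tendsto_elasticity hΛ
  elasticity_mem_uIcc s hs := by
    have hcont : ContinuousOn (fun t => elasticity φ t - 1) (Ioi 0) := by
      simp only [elasticity, add_sub_cancel_left]
      exact (continuousOn_id.mul (hφ.contDiffOn.continuousOn_deriv_of_isOpen isOpen_Ioi le_rfl)).div
        hφ.contDiffOn.continuousOn fun t ht => (hφ.pos t ht).ne'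
    have hmono : MonotoneOn (fun t => |elasticity φ t - 1|) (Ioi 0) := by
      simpa only [elasticity, add_sub_cancel_left] using hφ.monotone
    have hmem := mem_uIcc_zero_of_monotoneOn_abs hcont hmono
      ((hφ.tendsto_elasticity hΛ).sub_const 1) hs
    rw [mem_uIcc] at hmem ⊢
    simpa only [sub_nonneg, sub_nonpos, sub_le_sub_iff_right] using hmem

end PhiAdmissible

end AdmissibleWeights

section Profile

lemma hasDerivAt_comp_sq {K : NNReal} {k : ℝ → ℝ} (hLip : LipschitzWith K k)
    (hk : DifferentiableOn ℝ k (Ioi 0)) (t : ℝ) :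
    HasDerivAt (fun t => k (t ^ 2)) (2 * t * deriv k (t ^ 2)) t := by
  rcases eq_or_ne t 0 with rfl | ht
  · simp only [mul_zero, zero_mul]
    have hO : (fun t => k (t ^ 2) - k (0 ^ 2) - (t - 0) • (0 : ℝ)) =O[𝓝 0] fun t : ℝ => t ^ 2 := by
      refine Asymptotics.IsBigO.of_bound K (Eventually.of_forall fun t => ?_)
      simpa only [dist_eq_norm, zero_pow two_ne_zero, smul_zero, sub_zero]
        using hLip.dist_le_mul (t ^ 2) 0
    refine hasDerivAt_iff_isLittleO.2 (hO.trans_isLittleO ?_)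
    simpa using Asymptotics.isLittleO_pow_id (𝕜 := ℝ) one_lt_two
  · have ht₂ : 0 < t ^ 2 := by positivity
    have hk' := (hk.differentiableAt (Ioi_mem_nhds ht₂)).hasDerivAt
    exact (HasDerivAt.comp (h := fun t => t ^ 2) t hk' (hasDerivAt_pow 2 t)).congr_deriv (by
      push_cast; ring)

lemma contDiff_comp_sq {K : NNReal} {k : ℝ → ℝ} (hLip : LipschitzWith K k)
    (hk : ContDiffOn ℝ 1 k (Ioi 0)) : ContDiff ℝ 1 fun t => k (t ^ 2) := by
  have hderiv := hasDerivAt_comp_sq hLip (hk.differentiableOn one_ne_zero)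
  refine contDiff_one_iff_deriv.2 ⟨fun t => (hderiv t).differentiableAt, ?_⟩
  rw [funext fun t => (hderiv t).deriv]
  refine continuous_iff_continuousAt.2 fun t => ?_
  rcases eq_or_ne t 0 with rfl | ht
  · have hbound : ∀ t : ℝ, ‖2 * t * deriv k (t ^ 2)‖ ≤ 2 * |t| * K := fun t => by
      rw [norm_mul, norm_mul, Real.norm_two, Real.norm_eq_abs]
      exact mul_le_mul_of_nonneg_left (norm_deriv_le_of_lipschitz hLip) (by positivity)
    have hlim : Tendsto (fun t : ℝ => 2 * |t| * K) (𝓝 0) (𝓝 0) :=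
      Continuous.tendsto' (by fun_prop) _ _ (by simp)
    rw [ContinuousAt, mul_zero, zero_mul]
    exact squeeze_zero_norm hbound hlim
  · have ht₂ : t ^ 2 ∈ Ioi (0 : ℝ) := mem_Ioi.2 (by positivity)
    have hk' := (hk.continuousOn_deriv_of_isOpen isOpen_Ioi le_rfl).continuousAt
      (Ioi_mem_nhds ht₂)
    exact (continuousAt_const.mul continuousAt_id).mul
      (ContinuousAt.comp (f := fun t : ℝ => t ^ 2) hk' (continuous_pow 2).continuousAt)

namespace IsRadialWeight

variable {φ : ℝ → ℝ} {p s : ℝ}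

lemma continuous_radialMap {E : Type*} [NormedAddCommGroup E] [InnerProductSpace ℝ E]
    (hφ : IsRadialWeight φ p) : Continuous (radialMap φ : E → E) := by
  refine continuous_iff_continuousAt.2 fun y => ?_
  rcases eq_or_ne y 0 with rfl | hy
  · rw [continuousAt_iff_punctured_nhds, radialMap_zero, tendsto_zero_iff_norm_tendsto_zero]
    refine (hφ.tendsto_mul_nhdsGT_zero.comp tendsto_norm_nhdsNE_zero).congr' ?_
    filter_upwards [self_mem_nhdsWithin] with y hy
    rw [Function.comp_apply, radialMap, norm_smul, Real.norm_eq_abs,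
      abs_of_pos (hφ.pos _ (norm_pos_iff.2 hy)), mul_comm]
  · exact (contDiffAt_radialMap hφ.contDiffOn hy).continuousAt

lemma radialMap_of_nonneg (hs : 0 ≤ s) : radialMap φ s = s * φ s := by
  rw [radialMap, Real.norm_of_nonneg hs, smul_eq_mul, mul_comm]

lemma strictMono_radialMap (hφ : IsRadialWeight φ p) : StrictMono (radialMap φ : ℝ → ℝ) := by
  refine strictMono_of_odd_strictMonoOn_nonneg (fun s => by simp [radialMap])
    fun s hs t ht hst => ?_
  have ht₀ : 0 < t := lt_of_le_of_lt hs hst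
  rw [radialMap_of_nonneg hs, radialMap_of_nonneg ht]
  rcases (mem_Ici.1 hs).eq_or_lt with rfl | hs₀
  · simpa using mul_pos ht₀ (hφ.pos t ht₀)
  · exact hφ.strictMonoOn_mul hs₀ ht₀ hst

lemma radialMap_nonneg (hφ : IsRadialWeight φ p) (hs : 0 ≤ s) : 0 ≤ radialMap φ s := by
  simpa using hφ.strictMono_radialMap.monotone hs

lemma surjective_add_radialMap (hφ : IsRadialWeight φ p) :
    Function.Surjective fun s : ℝ => s + radialMap φ s := by
  refine (continuous_id.add hφ.continuous_radialMap).surjective ?_ ?_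
  · refine tendsto_atTop_mono' _ ?_ tendsto_id
    filter_upwards [eventually_ge_atTop 0] with s hs
    exact le_add_of_nonneg_right (hφ.radialMap_nonneg hs)
  · refine tendsto_atBot_mono' _ ?_ tendsto_id
    filter_upwards [eventually_le_atBot 0] with s hs
    exact add_le_of_nonpos_right (by simpa using hφ.strictMono_radialMap.monotone hs)

/-- The increasing bijection `s ↦ s + φ(|s|) s` of the real line. Both `s` and `φ(|s|) s` are
Lipschitz functions of its value, whatever the behaviour of `φ` at `0`; this is what makes it
possible to build curves `v` for which `v` and `φ(|v|) v` are simultaneously `C¹`. -/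
noncomputable def profile (hφ : IsRadialWeight φ p) : ℝ ≃o ℝ :=
  (strictMono_id.add hφ.strictMono_radialMap).orderIsoOfSurjective _ hφ.surjective_add_radialMap

lemma profile_apply (hφ : IsRadialWeight φ p) (s : ℝ) : hφ.profile s = s + radialMap φ s := rfl

lemma radialMap_profile_symm (hφ : IsRadialWeight φ p) (t : ℝ) :
    radialMap φ (hφ.profile.symm t) = t - hφ.profile.symm t := by
  rw [eq_sub_iff_add_eq', ← hφ.profile_apply, OrderIso.apply_symm_apply]

lemma profile_symm_zero (hφ : IsRadialWeight φ p) : hφ.profile.symm 0 = 0 := by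
  rw [OrderIso.symm_apply_eq, hφ.profile_apply, radialMap_zero, add_zero]

lemma lipschitzWith_profile_symm (hφ : IsRadialWeight φ p) :
    LipschitzWith 1 hφ.profile.symm := by
  refine LipschitzWith.of_le_add fun x y => ?_
  rcases le_total x y with hxy | hxy
  · exact (hφ.profile.symm.monotone hxy).trans (le_add_of_nonneg_right dist_nonneg)
  · have hmono := hφ.strictMono_radialMap.monotone (hφ.profile.symm.monotone hxy)
    rw [radialMap_profile_symm, radialMap_profile_symm] at hmono
    rw [Real.dist_eq, abs_of_nonneg (sub_nonneg.2 hxy)]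
    linarith

lemma hasDerivAt_profile (hφ : IsRadialWeight φ p) (hs : 0 < s) :
    HasDerivAt hφ.profile (1 + φ s * elasticity φ s) s := by
  have hmul := hφ.hasDerivAt_rpow_mul hs 1
  simp only [Real.rpow_one, sub_self, Real.rpow_zero, one_mul, add_sub_cancel_right] at hmul
  refine ((hasDerivAt_id s).add hmul).congr_of_eventuallyEq ?_
  filter_upwards [eventually_gt_nhds hs] with t ht
  rw [hφ.profile_apply, radialMap_of_nonneg ht.le, Pi.add_apply, id]

lemma contDiffOn_profile_symm (hφ : IsRadialWeight φ p) :
    ContDiffOn ℝ 1 hφ.profile.symm (Ioi 0) := by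
  intro t ht
  have hs : 0 < hφ.profile.symm t := by
    simpa [hφ.profile_symm_zero] using hφ.profile.symm.strictMono ht
  have hderiv := hφ.hasDerivAt_profile hs
  have hne : 1 + φ (hφ.profile.symm t) * elasticity φ (hφ.profile.symm t) ≠ 0 :=
    (add_pos one_pos (mul_pos (hφ.pos _ hs) (hφ.elasticity_pos hs))).ne'
  have hcont : ContDiffAt ℝ 1 hφ.profile (hφ.profile.symm t) :=
    contDiffAt_id.add (contDiffAt_radialMap hφ.contDiffOn hs.ne')
  exact (hφ.profile.toHomeomorph.toOpenPartialHomeomorph.contDiffAt_symm_deriv hne (mem_univ _)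
    hderiv hcont).contDiffWithinAt

end IsRadialWeight

end Profile

section TestCurves

set_option maxSynthPendingDepth 3

lemma integrableOn_clm_apply_of_isCompact {X F G : Type*} [TopologicalSpace X] [MeasurableSpace X]
    [OpensMeasurableSpace X] [SecondCountableTopology X] [T2Space X] {μ : Measure X}
    [NormedAddCommGroup F] [NormedSpace ℝ F] [NormedAddCommGroup G] [NormedSpace ℝ G]
    {K : Set X} {T : X → F →L[ℝ] G} {g : X → F} (hK : IsCompact K) (hT : IntegrableOn T K μ)
    (hg : ContinuousOn g K) : IntegrableOn (fun x => T x (g x)) K μ := by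
  obtain ⟨C, hC⟩ := hK.exists_bound_of_continuousOn hg
  exact (ContinuousLinearMap.id ℝ (F →L[ℝ] G)).integrable_of_bilin_of_bdd_right C hT
    (hg.aestronglyMeasurable hK.measurableSet) (ae_restrict_of_forall_mem hK.measurableSet hC)

/-- `C¹` curves with compact support in `I`: the notion `IsC1c` for curves in any normed space. -/
def IsTestCurve {F : Type*} [NormedAddCommGroup F] [NormedSpace ℝ F] (I : Set ℝ) (u : ℝ → F) :
    Prop :=
  ContDiff ℝ 1 u ∧ HasCompactSupport u ∧ tsupport u ⊆ I

lemma isTestCurve_of_forall_notMem {F : Type*} [NormedAddCommGroup F] [NormedSpace ℝ F]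
    {I K : Set ℝ} {u : ℝ → F} (hu : ContDiff ℝ 1 u) (hK : IsCompact K) (hKI : K ⊆ I)
    (hzero : ∀ x ∉ K, u x = 0) : IsTestCurve I u :=
  ⟨hu, HasCompactSupport.intro hK hzero, (closure_minimal
    (fun x hx => not_imp_comm.1 (hzero x) hx) hK.isClosed).trans hKI⟩

namespace IsTestCurve

variable {F G : Type*} [NormedAddCommGroup F] [NormedSpace ℝ F] [NormedAddCommGroup G]
  [NormedSpace ℝ G] {I : Set ℝ} {u : ℝ → F} {w : ℝ → G}

lemma deriv_eq_zero_of_notMem {x : ℝ} (hx : x ∉ tsupport u) : deriv u x = 0 :=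
  image_eq_zero_of_notMem_tsupport fun h => hx (tsupport_deriv_subset h)

lemma add (hu : IsTestCurve I u) {u' : ℝ → F} (hu' : IsTestCurve I u') :
    IsTestCurve I (u + u') :=
  ⟨hu.1.add hu'.1, hu.2.1.add hu'.2.1, (tsupport_add u u').trans (union_subset hu.2.2 hu'.2.2)⟩

lemma integrable_bilin {B : ℝ → F →L[ℝ] G →L[ℝ] ℝ} (hB : LocallyIntegrableOn B I)
    (hu : IsTestCurve I u) (hw : IsTestCurve I w) :
    Integrable fun x => B x (deriv u x) (deriv w x) := by
  have hK : IsCompact (tsupport w) := hw.2.1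
  have hint := integrableOn_clm_apply_of_isCompact hK
    (integrableOn_clm_apply_of_isCompact hK (hB.integrableOn_compact_subset hw.2.2 hK)
      (hu.1.continuous_deriv le_rfl).continuousOn)
    (hw.1.continuous_deriv le_rfl).continuousOn
  exact hint.integrable_of_forall_notMem_eq_zero fun x hx => by
    rw [deriv_eq_zero_of_notMem hx, map_zero]

end IsTestCurve

variable {E : Type*} [NormedAddCommGroup E] [InnerProductSpace ℝ E]
  {φ : ℝ → ℝ} {p c r R : ℝ} {I : Set ℝ} {y l : E} {v : ℝ → E} {ρ : ℝ → ℝ}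

lemma radialMap_smul_of_norm_eq_one (ψ : ℝ → ℝ) {e : E} (he : ‖e‖ = 1) (s : ℝ) :
    radialMap ψ (s • e) = radialMap ψ s • e := by
  rw [radialMap, radialMap, norm_smul, he, mul_one, smul_smul, smul_eq_mul]

lemma IsRadialWeight.exists_isTestCurve_eventuallyEq_const (hφ : IsRadialWeight φ p) (hr : 0 < r)
    (hrR : r < R) (hR : Metric.closedBall c R ⊆ I) (hy : y ≠ 0) :
    ∃ v : ℝ → E, IsTestCurve I v ∧ IsTestCurve I (radialMap φ ∘ v) ∧
      ∀ x ∈ Metric.closedBall c r, v =ᶠ[𝓝 x] fun _ => y := by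
  have hK := isCompact_closedBall c R
  let τ : ContDiffBump c := ⟨(r + R) / 2, R, by linarith, by linarith⟩
  let k := hφ.profile.symm
  let T := √(hφ.profile ‖y‖)
  have hunit : ‖‖y‖⁻¹ • y‖ = 1 := norm_smul_inv_norm (𝕜 := ℝ) hy
  have hTτ : ContDiff ℝ 1 fun x => T * τ x := contDiff_const.mul τ.contDiff
  have hk : ContDiff ℝ 1 fun x => k ((T * τ x) ^ 2) :=
    (contDiff_comp_sq hφ.lipschitzWith_profile_symm hφ.contDiffOn_profile_symm).comp hTτ
  have hτ : ∀ x ∉ Metric.closedBall c R, τ x = 0 := fun x hx =>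
    τ.zero_of_le_dist (not_le.1 hx).le
  have hk₀ : k 0 = 0 := hφ.profile_symm_zero
  have hradial : (radialMap φ ∘ fun x => k ((T * τ x) ^ 2) • ‖y‖⁻¹ • y) =
      fun x => ((T * τ x) ^ 2 - k ((T * τ x) ^ 2)) • ‖y‖⁻¹ • y := by
    funext x
    rw [Function.comp_apply, radialMap_smul_of_norm_eq_one φ hunit, hφ.radialMap_profile_symm]
  refine ⟨fun x => k ((T * τ x) ^ 2) • ‖y‖⁻¹ • y, ?_, ?_, fun x hx => ?_⟩
  · exact isTestCurve_of_forall_notMem (hk.smul contDiff_const) hK hR fun x hx => by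
      simp [hτ x hx, hk₀]
  · rw [hradial]
    exact isTestCurve_of_forall_notMem (((hTτ.pow 2).sub hk).smul contDiff_const) hK hR
      fun x hx => by simp [hτ x hx, hk₀]
  · have hxτ : x ∈ Metric.ball c τ.rIn := Metric.closedBall_subset_ball (by
      change r < (r + R) / 2; linarith) hx
    have hT : T ^ 2 = hφ.profile ‖y‖ := Real.sq_sqrt (by
      rw [hφ.profile_apply]; linarith [norm_nonneg y, hφ.radialMap_nonneg (norm_nonneg y)])
    filter_upwards [τ.eventuallyEq_one_of_mem_ball hxτ] with z hz
    rw [hz, Pi.one_apply, mul_one, hT, OrderIso.symm_apply_apply,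
      smul_inv_smul₀ (norm_ne_zero_iff.2 hy)]

section Perturbation

variable (hv : ∀ x ∈ tsupport ρ, v =ᶠ[𝓝 x] fun _ => y)
include hv

lemma eventuallyEq_add_smul_of_mem_tsupport {x : ℝ} (hx : x ∈ tsupport ρ) :
    (fun x => v x + ρ x • l) =ᶠ[𝓝 x] fun x => y + ρ x • l := by
  filter_upwards [hv x hx] with z hz using by rw [hz]

omit hv in
lemma eventuallyEq_add_smul_of_notMem_tsupport {x : ℝ} (hx : x ∉ tsupport ρ) :
    (fun x => v x + ρ x • l) =ᶠ[𝓝 x] v := by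
  filter_upwards [notMem_tsupport_iff_eventuallyEq.1 hx] with z hz using by simp [hz]

lemma contDiff_radialMap_add_smul (hφ : ContDiffOn ℝ 1 φ (Ioi 0)) (hρ : ContDiff ℝ 1 ρ)
    (hne : ∀ x, y + ρ x • l ≠ 0) (hvΦ : ContDiff ℝ 1 (radialMap φ ∘ v)) :
    ContDiff ℝ 1 (radialMap φ ∘ fun x => v x + ρ x • l) := by
  refine contDiff_iff_contDiffAt.2 fun x => ?_
  by_cases hx : x ∈ tsupport ρ
  · refine ContDiffAt.congr_of_eventuallyEq ?_
      ((eventuallyEq_add_smul_of_mem_tsupport hv hx).fun_comp (radialMap φ))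
    exact ContDiffAt.comp x (contDiffAt_radialMap hφ (hne x))
      (contDiff_const.add (hρ.smul contDiff_const)).contDiffAt
  · exact hvΦ.contDiffAt.congr_of_eventuallyEq
      ((eventuallyEq_add_smul_of_notMem_tsupport hx).fun_comp (radialMap φ))

lemma apply_deriv_add_smul (B : E →L[ℝ] E →L[ℝ] ℝ) (hφ : ContDiffOn ℝ 1 φ (Ioi 0))
    (hρ : ContDiff ℝ 1 ρ) (hne : ∀ x, y + ρ x • l ≠ 0) (x : ℝ) :
    B (deriv (fun x => v x + ρ x • l) x) (deriv (radialMap φ ∘ fun x => v x + ρ x • l) x) =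
      B l (deriv ρ x ^ 2 • fderiv ℝ (radialMap φ) (y + ρ x • l) l) +
        B (deriv v x) (deriv (radialMap φ ∘ v) x) := by
  by_cases hx : x ∈ tsupport ρ
  · have hline : HasDerivAt (fun x => y + ρ x • l) (deriv ρ x • l) x :=
      (((hρ.differentiable one_ne_zero) x).hasDerivAt.smul_const l).const_add y
    have hΦ := (((contDiffAt_radialMap hφ (hne x)).differentiableAt
      one_ne_zero).hasFDerivAt.comp_hasDerivAt x hline).deriv
    have hu := eventuallyEq_add_smul_of_mem_tsupport (l := l) hv hx
    have hv' : deriv v x = 0 := by rw [(hv x hx).deriv_eq, deriv_const]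
    rw [hu.deriv_eq, (hu.fun_comp (radialMap φ)).deriv_eq, hline.deriv, hv', map_zero,
      zero_apply, add_zero]
    refine (congrArg _ hΦ).trans ?_
    simp only [map_smul, smul_apply, smul_eq_mul]
    ring
  · have hu := eventuallyEq_add_smul_of_notMem_tsupport (v := v) (l := l) hx
    rw [hu.deriv_eq, (hu.fun_comp (radialMap φ)).deriv_eq,
      IsTestCurve.deriv_eq_zero_of_notMem hx, zero_pow two_ne_zero, zero_smul, map_zero, zero_add]

lemma isTestCurve_radialMap_add_smul (hφ : ContDiffOn ℝ 1 φ (Ioi 0)) (hvI : IsTestCurve I v)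
    (hvΦ : IsTestCurve I (radialMap φ ∘ v)) (hρ : IsTestCurve I ρ)
    (hne : ∀ x, y + ρ x • l ≠ 0) :
    IsTestCurve I (radialMap φ ∘ fun x => v x + ρ x • l) := by
  refine isTestCurve_of_forall_notMem (contDiff_radialMap_add_smul hv hφ hρ.1 hne hvΦ.1)
    (IsCompact.union hvI.2.1 hρ.2.1) (union_subset hvI.2.2 hρ.2.2) fun x hx => ?_
  rw [mem_union, not_or] at hx
  simp [image_eq_zero_of_notMem_tsupport hx.1, image_eq_zero_of_notMem_tsupport hx.2]

end Perturbation

/-- The abstract form of `IsPhiDissipative`, for a field `B` of real bilinear forms on a real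
inner product space. -/
def IsFormDissipative (φ : ℝ → ℝ) (I : Set ℝ) (B : ℝ → E →L[ℝ] E →L[ℝ] ℝ) : Prop :=
  ∀ u : ℝ → E, IsTestCurve I u → IsTestCurve I (radialMap φ ∘ u) →
    0 ≤ ∫ x in I, B x (deriv u x) (deriv (radialMap φ ∘ u) x)

variable {B : ℝ → E →L[ℝ] E →L[ℝ] ℝ}

lemma integrableOn_apply_sq_smul_fderiv (hφ : IsRadialWeight φ p) {K : Set ℝ} (hK : IsCompact K)
    (hB : IntegrableOn B K) (hρ : ContDiff ℝ 1 ρ) (hne : ∀ x, y + ρ x • l ≠ 0) :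
    IntegrableOn (fun x => B x l (deriv ρ x ^ 2 • fderiv ℝ (radialMap φ) (y + ρ x • l) l)) K := by
  have hline : Continuous fun x => y + ρ x • l :=
    continuous_const.add (hρ.continuous.smul continuous_const)
  have hfderiv := (continuousOn_fderiv_radialMap hφ.contDiffOn).comp_continuous hline hne
  exact integrableOn_clm_apply_of_isCompact hK
    (integrableOn_clm_apply_of_isCompact hK hB continuousOn_const)
    (((hρ.continuous_deriv le_rfl).pow 2).smul (hfderiv.clm_apply continuous_const)).continuousOn

lemma IsFormDissipative.exists_forall_integral_add_nonneg (hd : IsFormDissipative φ I B)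
    (hφ : IsRadialWeight φ p) (hI : MeasurableSet I) (hB : LocallyIntegrableOn B I) (hr : 0 < r)
    (hrR : r < R) (hR : Metric.closedBall c R ⊆ I) (hy : y ≠ 0) (l : E) :
    ∃ J : ℝ, ∀ ρ : ℝ → ℝ, ContDiff ℝ 1 ρ → tsupport ρ ⊆ Metric.closedBall c r →
      (∀ x, y + ρ x • l ≠ 0) →
      0 ≤ (∫ x in Metric.closedBall c r,
        B x l (deriv ρ x ^ 2 • fderiv ℝ (radialMap φ) (y + ρ x • l) l)) + J := by
  obtain ⟨v, hvI, hvΦ, hvy⟩ :=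
    hφ.exists_isTestCurve_eventuallyEq_const (E := E) hr hrR hR hy
  refine ⟨∫ x in I, B x (deriv v x) (deriv (radialMap φ ∘ v) x), fun ρ hρ hsupp hne => ?_⟩
  have hK : IsCompact (Metric.closedBall c r) := isCompact_closedBall c r
  have hKI : Metric.closedBall c r ⊆ I := (Metric.closedBall_subset_closedBall hrR.le).trans hR
  have hv : ∀ x ∈ tsupport ρ, v =ᶠ[𝓝 x] fun _ => y := fun x hx => hvy x (hsupp hx)
  have hρI : IsTestCurve I ρ := isTestCurve_of_forall_notMem hρ hK hKI fun x hx =>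
    image_eq_zero_of_notMem_tsupport fun h => hx (hsupp h)
  have hρl : IsTestCurve I fun x => ρ x • l :=
    isTestCurve_of_forall_notMem (hρ.smul contDiff_const) hK hKI fun x hx => by
      rw [image_eq_zero_of_notMem_tsupport fun h => hx (hsupp h), zero_smul]
  have hzero : ∀ x ∈ I \ Metric.closedBall c r,
      B x l (deriv ρ x ^ 2 • fderiv ℝ (radialMap φ) (y + ρ x • l) l) = 0 := fun x hx => by
    rw [IsTestCurve.deriv_eq_zero_of_notMem fun h => hx.2 (hsupp h), zero_pow two_ne_zero,
      zero_smul, map_zero]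
  have hint := integrableOn_apply_sq_smul_fderiv hφ hK (hB.integrableOn_compact_subset hKI hK)
    hρ hne
  have hnonneg := hd _ (hvI.add hρl)
    (isTestCurve_radialMap_add_smul hv hφ.contDiffOn hvI hvΦ hρI hne)
  rw [← setIntegral_eq_of_subset_of_forall_sdiff_eq_zero hI hKI hzero,
    ← integral_add (hint.of_forall_sdiff_eq_zero hI hzero)
      (hvI.integrable_bilin hB hvΦ).integrableOn]
  exact hnonneg.trans_eq (integral_congr_ae (Eventually.of_forall fun x =>
    apply_deriv_add_smul hv (B x) hφ.contDiffOn hρ hne x))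

end TestCurves

section Oscillation

/-- The modulation of the profile `ζ` with amplitude `N⁻¹`, frequency `N²` and phase `α`. As
`N → ∞` it tends to `0` uniformly, while the square of its derivative is of size `N²`. -/
noncomputable def modulation (ζ : ℝ → ℝ) (N α x : ℝ) : ℝ := N⁻¹ * (ζ x * Real.sin (N ^ 2 * x + α))

variable {ζ : ℝ → ℝ} {N α x C : ℝ}

lemma contDiff_modulation (hζ : ContDiff ℝ 1 ζ) : ContDiff ℝ 1 (modulation ζ N α) := by
  unfold modulation
  fun_prop

lemma tsupport_modulation_subset : tsupport (modulation ζ N α) ⊆ tsupport ζ :=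
  closure_mono fun x hx hζ => hx (by simp [modulation, hζ])

lemma abs_modulation_le (hN : 0 < N) (hζ : |ζ x| ≤ C) : |modulation ζ N α x| ≤ N⁻¹ * C := by
  rw [modulation, abs_mul, abs_mul, abs_of_pos (inv_pos.2 hN)]
  have := mul_le_mul hζ (Real.abs_sin_le_one (N ^ 2 * x + α)) (abs_nonneg _)
    ((abs_nonneg _).trans hζ)
  exact mul_le_mul_of_nonneg_left (by simpa using this) (inv_pos.2 hN).le

lemma inv_mul_deriv_modulation (hζ : DifferentiableAt ℝ ζ x) (hN : N ≠ 0) :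
    N⁻¹ * deriv (modulation ζ N α) x = N⁻¹ ^ 2 * deriv ζ x * Real.sin (N ^ 2 * x + α) +
      ζ x * Real.cos (N ^ 2 * x + α) := by
  have hphase : HasDerivAt (fun x => N ^ 2 * x + α) (N ^ 2) x := by
    simpa using ((hasDerivAt_id x).const_mul (N ^ 2)).add_const α
  have hderiv : HasDerivAt (modulation ζ N α) _ x :=
    (hζ.hasDerivAt.mul hphase.sin).const_mul N⁻¹
  rw [hderiv.deriv]
  field_simp

lemma sq_inv_mul_deriv_modulation_add_sq (hζ : DifferentiableAt ℝ ζ x) (hN : N ≠ 0) :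
    (N⁻¹ * deriv (modulation ζ N 0) x) ^ 2 +
      (N⁻¹ * deriv (modulation ζ N (Real.pi / 2)) x) ^ 2 =
      ζ x ^ 2 + (N⁻¹ ^ 2 * deriv ζ x) ^ 2 := by
  rw [inv_mul_deriv_modulation hζ hN, inv_mul_deriv_modulation hζ hN, add_zero,
    Real.sin_add_pi_div_two, Real.cos_add_pi_div_two]
  linear_combination (ζ x ^ 2 + (N⁻¹ ^ 2 * deriv ζ x) ^ 2) * Real.sin_sq_add_cos_sq (N ^ 2 * x)

lemma abs_inv_mul_deriv_modulation_le (hζ : DifferentiableAt ℝ ζ x) (hN : 1 ≤ N)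
    (hC : |ζ x| ≤ C) (hC' : |deriv ζ x| ≤ C) :
    |N⁻¹ * deriv (modulation ζ N α) x| ≤ 2 * C := by
  have hN₀ : 0 < N := one_pos.trans_le hN
  have hinv : N⁻¹ ^ 2 ≤ 1 := pow_le_one₀ (inv_pos.2 hN₀).le (inv_le_one_of_one_le₀ hN)
  rw [inv_mul_deriv_modulation hζ hN₀.ne', two_mul]
  refine (abs_add_le _ _).trans (add_le_add ?_ ?_) <;> rw [abs_mul]
  · rw [abs_mul, abs_of_nonneg (sq_nonneg N⁻¹)]
    calc N⁻¹ ^ 2 * |deriv ζ x| * |Real.sin (N ^ 2 * x + α)|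
        ≤ 1 * C * 1 := by
          have := (abs_nonneg _).trans hC
          gcongr
          exact Real.abs_sin_le_one _
      _ = C := by ring
  · calc |ζ x| * |Real.cos (N ^ 2 * x + α)| ≤ C * 1 := by
          have := (abs_nonneg _).trans hC
          gcongr
          exact Real.abs_cos_le_one _
      _ = C := mul_one C

lemma tendsto_modulation (ζ : ℝ → ℝ) (α x : ℝ) :
    Tendsto (fun N => modulation ζ N α x) atTop (𝓝 0) := by
  refine squeeze_zero_norm' ?_ (zero_mul |ζ x| ▸ tendsto_inv_atTop_zero.mul_const |ζ x|)
  filter_upwards [eventually_gt_atTop 0] with N hN using abs_modulation_le hN le_rfl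

variable {F : Type*} [NormedAddCommGroup F] [NormedSpace ℝ F] {g : ℝ → F}

lemma tendsto_sq_deriv_modulation_smul (hζ : DifferentiableAt ℝ ζ x) (hg : ContinuousAt g 0) :
    Tendsto (fun N => (N⁻¹ * deriv (modulation ζ N 0) x) ^ 2 • g (modulation ζ N 0 x) +
      (N⁻¹ * deriv (modulation ζ N (Real.pi / 2)) x) ^ 2 • g (modulation ζ N (Real.pi / 2) x))
      atTop (𝓝 (ζ x ^ 2 • g 0)) := by
  -- The squares oscillate; only their sum converges, so `g` is first frozen at `0`.
  have herror : ∀ α, Tendsto (fun N => (N⁻¹ * deriv (modulation ζ N α) x) ^ 2 •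
      (g (modulation ζ N α x) - g 0)) atTop (𝓝 0) := fun α => by
    have hdiff : Tendsto (fun N => g (modulation ζ N α x) - g 0) atTop (𝓝 0) := by
      simpa using (hg.tendsto.comp (tendsto_modulation ζ α x)).sub_const (g 0)
    have hbound := hdiff.norm.const_mul ((2 * max |ζ x| |deriv ζ x|) ^ 2)
    rw [norm_zero, mul_zero] at hbound
    refine squeeze_zero_norm' ?_ hbound
    filter_upwards [eventually_ge_atTop 1] with N hN
    rw [norm_smul, norm_pow]
    gcongr
    exact abs_inv_mul_deriv_modulation_le hζ hN (le_max_left _ _) (le_max_right _ _)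
  have hsum : Tendsto (fun N => (ζ x ^ 2 + (N⁻¹ ^ 2 * deriv ζ x) ^ 2) • g 0) atTop
      (𝓝 (ζ x ^ 2 • g 0)) := by
    have hinv := ((tendsto_inv_atTop_zero (𝕜 := ℝ)).pow 2).mul_const (deriv ζ x)
    simpa using ((hinv.pow 2).const_add (ζ x ^ 2)).smul_const (g 0)
  have htotal := (hsum.add (herror 0)).add (herror (Real.pi / 2))
  rw [add_zero, add_zero] at htotal
  refine htotal.congr' ?_
  filter_upwards [eventually_ne_atTop 0] with N hN
  rw [← sq_inv_mul_deriv_modulation_add_sq hζ hN]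
  module

lemma tendsto_setIntegral_clm_apply {X ι G : Type*} [MeasurableSpace X] [NormedAddCommGroup G]
    [NormedSpace ℝ G] {μ : Measure X} {l : Filter ι} [l.IsCountablyGenerated] {K : Set X}
    {T : X → F →L[ℝ] G} {q : ι → X → F} {q₀ : X → F} (hK : MeasurableSet K)
    (hT : IntegrableOn T K μ) (hq : ∀ᶠ n in l, AEStronglyMeasurable (q n) (μ.restrict K))
    (hC : ∀ᶠ n in l, ∀ x ∈ K, ‖q n x‖ ≤ C) (hlim : ∀ x ∈ K, Tendsto (q · x) l (𝓝 (q₀ x))) :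
    Tendsto (fun n => ∫ x in K, T x (q n x) ∂μ) l (𝓝 (∫ x in K, T x (q₀ x) ∂μ)) := by
  refine tendsto_integral_filter_of_dominated_convergence (fun x => ‖T x‖ * C) ?_ ?_
    (hT.norm.mul_const C) (ae_restrict_of_forall_mem hK fun x hx =>
      ((T x).continuous.tendsto _).comp (hlim x hx))
  · filter_upwards [hq] with n hn
    exact (ContinuousLinearMap.id ℝ (F →L[ℝ] G)).aestronglyMeasurable_comp₂ hT.1 hn
  · filter_upwards [hC] with n hn
    exact ae_restrict_of_forall_mem hK fun x hx => (T x).le_opNorm_of_le (hn x hx)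

variable {K : Set ℝ} {T : ℝ → F →L[ℝ] ℝ} {δ J : ℝ}

lemma eventually_abs_modulation_le (hζ : Continuous ζ) (hsupp : HasCompactSupport ζ) (hδ : 0 < δ) :
    ∀ᶠ N in atTop, ∀ α x, |modulation ζ N α x| ≤ δ := by
  obtain ⟨C, hC⟩ := hζ.bounded_above_of_compact_support hsupp
  have hlim : Tendsto (fun N : ℝ => N⁻¹ * C) atTop (𝓝 0) :=
    zero_mul C ▸ tendsto_inv_atTop_zero.mul_const C
  filter_upwards [eventually_gt_atTop 0, hlim.eventually_le_const hδ] with N hN hNδ α x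
  exact (abs_modulation_le hN (hC x)).trans hNδ

lemma continuous_sq_deriv_modulation_smul (hζ : ContDiff ℝ 1 ζ)
    (hg : ContinuousOn g (Icc (-δ) δ)) (hN : ∀ x, |modulation ζ N α x| ≤ δ) :
    Continuous fun x => (N⁻¹ * deriv (modulation ζ N α) x) ^ 2 • g (modulation ζ N α x) := by
  have hρ := contDiff_modulation (N := N) (α := α) hζ
  exact ((continuous_const.mul (hρ.continuous_deriv le_rfl)).pow 2).smul
    (hg.comp_continuous hρ.continuous fun x => abs_le.1 (hN x))

lemma tendsto_setIntegral_sq_deriv_modulation_smul (hK : MeasurableSet K) (hT : IntegrableOn T K)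
    (hδ : 0 < δ) (hg : ContinuousOn g (Icc (-δ) δ)) (hζ : ContDiff ℝ 1 ζ)
    (hsupp : HasCompactSupport ζ) :
    Tendsto (fun N => ∫ x in K, T x ((N⁻¹ * deriv (modulation ζ N 0) x) ^ 2 •
        g (modulation ζ N 0 x) + (N⁻¹ * deriv (modulation ζ N (Real.pi / 2)) x) ^ 2 •
        g (modulation ζ N (Real.pi / 2) x))) atTop (𝓝 (∫ x in K, T x (ζ x ^ 2 • g 0))) := by
  have hζ' : ∀ x, DifferentiableAt ℝ ζ x := hζ.differentiable one_ne_zero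
  obtain ⟨C₁, hC₁⟩ := hζ.continuous.bounded_above_of_compact_support hsupp
  obtain ⟨C₂, hC₂⟩ := (hζ.continuous_deriv le_rfl).bounded_above_of_compact_support hsupp.deriv
  obtain ⟨G, hG⟩ := isCompact_Icc.exists_bound_of_continuousOn hg
  have hsmall := eventually_abs_modulation_le hζ.continuous hsupp hδ
  have hbound : ∀ᶠ N in atTop, ∀ α x, ‖(N⁻¹ * deriv (modulation ζ N α) x) ^ 2 •
      g (modulation ζ N α x)‖ ≤ (2 * max C₁ C₂) ^ 2 * G := by
    filter_upwards [hsmall, eventually_ge_atTop 1] with N hN hN₁ α x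
    rw [norm_smul, norm_pow]
    gcongr
    · exact abs_inv_mul_deriv_modulation_le (hζ' x) hN₁ ((hC₁ x).trans (le_max_left _ _))
        ((hC₂ x).trans (le_max_right _ _))
    · exact hG _ (abs_le.1 (hN α x))
  refine tendsto_setIntegral_clm_apply hK hT ?_
    (hbound.mono fun N hN x _ => norm_add_le_of_le (hN 0 x) (hN (Real.pi / 2) x))
    fun x _ => tendsto_sq_deriv_modulation_smul (hζ' x)
      (hg.continuousAt (Icc_mem_nhds (neg_lt_zero.2 hδ) hδ))
  filter_upwards [hsmall] with N hN
  exact ((continuous_sq_deriv_modulation_smul hζ hg (hN 0)).add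
    (continuous_sq_deriv_modulation_smul hζ hg (hN (Real.pi / 2)))).aestronglyMeasurable

lemma setIntegral_sq_smul_nonneg_of_forall (hK : IsCompact K) (hT : IntegrableOn T K) (hδ : 0 < δ)
    (hg : ContinuousOn g (Icc (-δ) δ))
    (h : ∀ ρ : ℝ → ℝ, ContDiff ℝ 1 ρ → tsupport ρ ⊆ K → (∀ x, |ρ x| ≤ δ) →
      0 ≤ (∫ x in K, T x (deriv ρ x ^ 2 • g (ρ x))) + J)
    (hζ : ContDiff ℝ 1 ζ) (hζK : tsupport ζ ⊆ K) :
    0 ≤ ∫ x in K, T x (ζ x ^ 2 • g 0) := by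
  have hsupp : HasCompactSupport ζ := hK.of_isClosed_subset (isClosed_tsupport ζ) hζK
  have hlim := tendsto_setIntegral_sq_deriv_modulation_smul hK.measurableSet hT hδ hg hζ hsupp
  -- Scaled by `N⁻²`, the fixed error `J` disappears in the limit.
  have hJ : Tendsto (fun N : ℝ => N⁻¹ ^ 2 * (2 * J)) atTop (𝓝 0) := by
    simpa using (tendsto_inv_atTop_zero.pow 2).mul_const (2 * J)
  refine ge_of_tendsto (add_zero (∫ x in K, T x (ζ x ^ 2 • g 0)) ▸ hlim.add hJ) ?_
  filter_upwards [eventually_abs_modulation_le hζ.continuous hsupp hδ] with N hN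
  have hint := fun α => integrableOn_clm_apply_of_isCompact hK hT
    (continuous_sq_deriv_modulation_smul hζ hg (hN α)).continuousOn
  have hρ : ∀ α, 0 ≤ (∫ x in K, T x ((N⁻¹ * deriv (modulation ζ N α) x) ^ 2 •
      g (modulation ζ N α x))) + N⁻¹ ^ 2 * J := fun α => by
    have := mul_nonneg (sq_nonneg N⁻¹) (h (modulation ζ N α) (contDiff_modulation hζ)
      (tsupport_modulation_subset.trans hζK) (hN α))
    simpa only [mul_add, ← integral_const_mul, mul_pow, mul_smul, map_smul, smul_eq_mul] using this
  simp only [map_add]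
  rw [integral_add (hint 0) (hint (Real.pi / 2))]
  linarith [hρ 0, hρ (Real.pi / 2)]

end Oscillation

section Localisation

lemma ae_nonneg_of_forall_eventually_setIntegral_closedBall_nonneg {α : Type*}
    [PseudoMetricSpace α] [MeasurableSpace α] [SecondCountableTopology α] [BorelSpace α]
    {μ : Measure α} [IsLocallyFiniteMeasure μ] [IsUnifLocDoublingMeasure μ] {U : Set α}
    {f : α → ℝ} (hU : IsOpen U) (hf : LocallyIntegrableOn f U μ)
    (h : ∀ x ∈ U, ∀ᶠ r in 𝓝[>] 0, 0 ≤ ∫ z in Metric.closedBall x r, f z ∂μ) :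
    ∀ᵐ x ∂μ.restrict U, 0 ≤ f x := by
  obtain ⟨u, hu, hUu, hint⟩ := hf.exists_nat_integrableOn
  have hloc : ∀ n, ∀ᵐ x ∂μ, x ∈ u n ∩ U → 0 ≤ f x := by
    intro n
    have hopen : IsOpen (u n ∩ U) := (hu n).inter hU
    have hdiff := IsUnifLocDoublingMeasure.ae_tendsto_average μ
      ((hint n).integrable_indicator hopen.measurableSet).locallyIntegrable 1
    filter_upwards [hdiff] with x hx hxn
    have hlim := hx (fun _ : ℝ => x) id tendsto_id (by
      filter_upwards [self_mem_nhdsWithin] with r hr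
      exact Metric.mem_closedBall_self (by simpa using (mem_Ioi.1 hr).le))
    rw [indicator_of_mem hxn] at hlim
    refine ge_of_tendsto hlim ?_
    obtain ⟨ε, hε, hball⟩ := Metric.isOpen_iff.1 hopen x hxn
    filter_upwards [h x hxn.2, Ioo_mem_nhdsGT hε] with r hr hrε
    have hsub := (Metric.closedBall_subset_ball hrε.2).trans hball
    rw [id, setAverage_eq, setIntegral_congr_fun Metric.isClosed_closedBall.measurableSet
      fun z hz => indicator_of_mem (hsub hz) f]
    exact smul_nonneg (inv_nonneg.2 measureReal_nonneg) hr
  rw [ae_restrict_iff' hU.measurableSet]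
  filter_upwards [ae_all_iff.2 hloc] with x hx hxU
  obtain ⟨n, hn⟩ := mem_iUnion.1 (hUu hxU)
  exact hx n ⟨hn, hxU⟩

lemma exists_seq_contDiffBump_tendsto_rOut {α : Type*} (c : α) {r R : ℝ} (hr : 0 < r)
    (hrR : r < R) :
    ∃ ζ : ℕ → ContDiffBump c, (∀ n, (ζ n).rIn = r) ∧ (∀ n, (ζ n).rOut ≤ R) ∧
      Tendsto (fun n => (ζ n).rOut) atTop (𝓝 r) := by
  obtain ⟨v, -, hv, hlim⟩ := exists_seq_strictAnti_tendsto' hrR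
  exact ⟨fun n => ⟨r, v n, hr, (hv n).1⟩, fun _ => rfl, fun n => (hv n).2.le, hlim⟩

variable {E : Type*} [NormedAddCommGroup E] [NormedSpace ℝ E] [HasContDiffBump E] {f : E → ℝ}
  {c : E} {r R : ℝ}

lemma tendsto_sq_contDiffBump_mul {ζ : ℕ → ContDiffBump c} (hrIn : ∀ n, (ζ n).rIn = r)
    (hrOut : Tendsto (fun n => (ζ n).rOut) atTop (𝓝 r)) (f : E → ℝ) (x : E) :
    Tendsto (fun n => ζ n x ^ 2 * f x) atTop (𝓝 ((Metric.closedBall c r).indicator f x)) := by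
  refine tendsto_const_nhds.congr' ?_
  by_cases hx : x ∈ Metric.closedBall c r
  · filter_upwards with n
    rw [indicator_of_mem hx, (ζ n).one_of_mem_closedBall ((hrIn n).symm ▸ hx), one_pow, one_mul]
  · filter_upwards [hrOut.eventually_le_const (not_le.1 hx)] with n hn
    rw [indicator_of_notMem hx, (ζ n).zero_of_le_dist hn, zero_pow two_ne_zero, zero_mul]

lemma setIntegral_closedBall_nonneg_of_forall_sq_mul [MeasurableSpace E] [BorelSpace E]
    {μ : Measure E} (hr : 0 < r) (hrR : r < R) (hf : IntegrableOn f (Metric.closedBall c R) μ)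
    (h : ∀ ζ : ContDiffBump c, ζ.rOut ≤ R → 0 ≤ ∫ x in Metric.closedBall c R, ζ x ^ 2 * f x ∂μ) :
    0 ≤ ∫ x in Metric.closedBall c r, f x ∂μ := by
  obtain ⟨ζ, hrIn, hζR, hrOut⟩ := exists_seq_contDiffBump_tendsto_rOut c hr hrR
  have hbound : ∀ n x, ‖ζ n x ^ 2 * f x‖ ≤ ‖f x‖ := fun n x => by
    rw [norm_mul, norm_pow, Real.norm_of_nonneg (ζ n).nonneg]
    exact mul_le_of_le_one_left (norm_nonneg _) (pow_le_one₀ (ζ n).nonneg (ζ n).le_one)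
  have hlim := tendsto_integral_of_dominated_convergence (fun x => ‖f x‖)
    (fun n => ((ζ n).continuous.pow 2).aestronglyMeasurable.mul hf.1) hf.norm
    (fun n => Eventually.of_forall (hbound n))
    (Eventually.of_forall (tendsto_sq_contDiffBump_mul hrIn hrOut f))
  rw [setIntegral_indicator Metric.isClosed_closedBall.measurableSet,
    inter_eq_self_of_subset_right (Metric.closedBall_subset_closedBall hrR.le)] at hlim
  exact ge_of_tendsto' hlim fun n => h (ζ n) (hζR n)

end Localisation

section Necessity

set_option maxSynthPendingDepth 3

open scoped RealInnerProductSpace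

variable {E : Type*} [NormedAddCommGroup E] [InnerProductSpace ℝ E]

lemma StretchNonneg.of_tendsto {ι : Type*} {a : Filter ι} [a.NeBot] {q : ι → ℝ} {p : ℝ}
    {B : E →L[ℝ] E →L[ℝ] ℝ} (hq : Tendsto q a (𝓝 p)) (h : ∀ᶠ i in a, StretchNonneg (q i) B) :
    StretchNonneg p B := by
  intro ξ η hξη
  have hlim : Tendsto (fun i => B (ξ + η) (q i • ξ + η)) a (𝓝 (B (ξ + η) (p • ξ + η))) :=
    ((B (ξ + η)).continuous.tendsto _).comp ((hq.smul_const ξ).add_const η)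
  exact ge_of_tendsto hlim (h.mono fun i hi => hi ξ η hξη)

variable {φ : ℝ → ℝ} {p c r R : ℝ} {I : Set ℝ} {y : E} {B : ℝ → E →L[ℝ] E →L[ℝ] ℝ}

lemma exists_forall_abs_le_add_smul_ne_zero (hy : y ≠ 0) (l : E) :
    ∃ δ > 0, ∀ t : ℝ, |t| ≤ δ → y + t • l ≠ 0 := by
  have hy₀ : 0 < ‖y‖ := norm_pos_iff.2 hy
  have hl : 0 < ‖l‖ + 1 := by positivity
  refine ⟨‖y‖ / (‖l‖ + 1), by positivity, fun t ht hzero => ?_⟩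
  have hnorm : ‖y‖ = |t| * ‖l‖ := by
    rw [eq_neg_of_add_eq_zero_left hzero, norm_neg, norm_smul, Real.norm_eq_abs]
  rw [le_div_iff₀ hl] at ht
  have : |t| = 0 := le_antisymm (by linarith) (abs_nonneg t)
  rw [this, zero_mul] at hnorm
  exact hy₀.ne' hnorm

lemma IsFormDissipative.setIntegral_sq_mul_nonneg (hd : IsFormDissipative φ I B)
    (hφ : IsRadialWeight φ p) (hI : MeasurableSet I) (hB : LocallyIntegrableOn B I) (hr : 0 < r)
    (hrR : r < R) (hR : Metric.closedBall c R ⊆ I) (hy : y ≠ 0) (l : E) {ζ : ℝ → ℝ}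
    (hζ : ContDiff ℝ 1 ζ) (hsupp : tsupport ζ ⊆ Metric.closedBall c r) :
    0 ≤ ∫ x in Metric.closedBall c r, ζ x ^ 2 * B x l (fderiv ℝ (radialMap φ) y l) := by
  obtain ⟨J, hJ⟩ := hd.exists_forall_integral_add_nonneg hφ hI hB hr hrR hR hy l
  obtain ⟨δ, hδ, hne⟩ := exists_forall_abs_le_add_smul_ne_zero hy l
  have hK : IsCompact (Metric.closedBall c r) := isCompact_closedBall c r
  have hT : IntegrableOn (fun x => B x l) (Metric.closedBall c r) :=
    integrableOn_clm_apply_of_isCompact hK (hB.integrableOn_compact_subset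
      ((Metric.closedBall_subset_closedBall hrR.le).trans hR) hK) continuousOn_const
  have hg : ContinuousOn (fun t : ℝ => fderiv ℝ (radialMap φ) (y + t • l) l) (Icc (-δ) δ) :=
    ((continuousOn_fderiv_radialMap hφ.contDiffOn).comp (by fun_prop)
      fun t ht => hne t (abs_le.2 ht)).clm_apply continuousOn_const
  simpa only [zero_smul, add_zero, map_smul, smul_eq_mul] using
    setIntegral_sq_smul_nonneg_of_forall hK hT hδ hg
      (fun ρ hρ hρK hρδ => hJ ρ hρ hρK fun x => hne _ (hρδ x)) hζ hsupp

lemma IsFormDissipative.ae_apply_fderiv_nonneg (hd : IsFormDissipative φ I B)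
    (hφ : IsRadialWeight φ p) (hI : IsOpen I) (hB : LocallyIntegrableOn B I) (hy : y ≠ 0) (l : E) :
    ∀ᵐ x ∂volume.restrict I, 0 ≤ B x l (fderiv ℝ (radialMap φ) y l) := by
  have hloc : LocallyIntegrableOn (fun x => B x l (fderiv ℝ (radialMap φ) y l)) I :=
    (locallyIntegrableOn_iff hI.isLocallyClosed).2 fun K hKI hK =>
      integrableOn_clm_apply_of_isCompact hK (integrableOn_clm_apply_of_isCompact hK
        (hB.integrableOn_compact_subset hKI hK) continuousOn_const) continuousOn_const
  refine ae_nonneg_of_forall_eventually_setIntegral_closedBall_nonneg hI hloc fun c hc => ?_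
  obtain ⟨ε, hε, hball⟩ := Metric.nhds_basis_closedBall.mem_iff.1 (hI.mem_nhds hc)
  filter_upwards [Ioo_mem_nhdsGT hε] with r hr
  obtain ⟨R, hrR, hRε⟩ := exists_between hr.2
  refine setIntegral_closedBall_nonneg_of_forall_sq_mul hr.1 hrR
    (hloc.integrableOn_compact_subset ((Metric.closedBall_subset_closedBall hRε.le).trans hball)
      (isCompact_closedBall c R)) fun ζ hζ => ?_
  exact hd.setIntegral_sq_mul_nonneg hφ hI.measurableSet hB (hr.1.trans hrR) hRε hball hy l
    ζ.contDiff (ζ.tsupport_eq ▸ Metric.closedBall_subset_closedBall hζ)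

lemma continuousOn_apply_fderiv_radialMap (hφ : ContDiffOn ℝ 1 φ (Ioi 0))
    (b : E →L[ℝ] E →L[ℝ] ℝ) :
    ContinuousOn (fun z : E × E => b z.2 (fderiv ℝ (radialMap φ) z.1 z.2)) ({0}ᶜ ×ˢ univ) := by
  have hfderiv := (continuousOn_fderiv_radialMap hφ).comp (t := {0}ᶜ)
    (continuousOn_fst (s := ({0}ᶜ : Set E) ×ˢ (univ : Set E))) fun z hz => hz.1
  exact (b.continuous.comp_continuousOn continuousOn_snd).clm_apply
    (hfderiv.clm_apply continuousOn_snd)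

lemma IsFormDissipative.ae_forall_apply_fderiv_nonneg [SecondCountableTopology E]
    (hd : IsFormDissipative φ I B) (hφ : IsRadialWeight φ p) (hI : IsOpen I)
    (hB : LocallyIntegrableOn B I) :
    ∀ᵐ x ∂volume.restrict I, ∀ y ≠ 0, ∀ l, 0 ≤ B x l (fderiv ℝ (radialMap φ) y l) := by
  obtain ⟨D, hDc, hD⟩ := TopologicalSpace.exists_countable_dense (E × E)
  have hae : ∀ᵐ x ∂volume.restrict I, ∀ z ∈ D, z.1 ≠ 0 →
      0 ≤ B x z.2 (fderiv ℝ (radialMap φ) z.1 z.2) :=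
    (ae_ball_iff hDc).2 fun z _ => by
      by_cases hz : z.1 = 0
      · exact Eventually.of_forall fun x h => absurd hz h
      · exact (hd.ae_apply_fderiv_nonneg hφ hI hB hz z.2).mono fun x hx _ => hx
  filter_upwards [hae] with x hx y hy l
  have hopen : IsOpen (({0}ᶜ : Set E) ×ˢ (univ : Set E)) := isOpen_compl_singleton.prod isOpen_univ
  have hmem : (y, l) ∈ ({0}ᶜ : Set E) ×ˢ (univ : Set E) := ⟨hy, mem_univ l⟩
  exact ContinuousWithinAt.closure_le (hD.open_subset_closure_inter hopen hmem)
    continuousWithinAt_const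
    ((continuousOn_apply_fderiv_radialMap hφ.contDiffOn (B x) _ hmem).mono inter_subset_left)
    fun z hz => hx z hz.2 hz.1.1

lemma IsFormDissipative.ae_stretchNonneg [SecondCountableTopology E]
    (hd : IsFormDissipative φ I B) (hφ : IsRadialWeight φ p) (hI : IsOpen I)
    (hB : LocallyIntegrableOn B I) : ∀ᵐ x ∂volume.restrict I, StretchNonneg p (B x) := by
  filter_upwards [hd.ae_forall_apply_fderiv_nonneg hφ hI hB] with x hx
  refine StretchNonneg.of_tendsto hφ.tendsto_elasticity ?_
  filter_upwards [eventually_gt_atTop 0] with s hs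
  exact stretchNonneg_of_apply_fderiv_radialMap_nonneg hs (hφ.differentiableAt hs) (hφ.pos s hs)
    (hφ.elasticity_pos hs) hx

end Necessity

section Sufficiency

set_option maxSynthPendingDepth 3

lemma ae_deriv_eq_zero_of_eq_zero {F : Type*} [NormedAddCommGroup F] [NormedSpace ℝ F]
    (u : ℝ → F) : ∀ᵐ x, u x = 0 → deriv u x = 0 := by
  -- All but countably many zeros of `u` are limits of zeros from the right.
  filter_upwards [(countable_setOfPred_isolated_right_within
    (s := {x | u x = 0})).ae_notMem volume] with x hx hux
  by_cases hd : DifferentiableAt ℝ u x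
  · have : (𝓝[{z | u z = 0} ∩ Ioi x] x).NeBot := neBot_iff.2 fun hbot => hx ⟨hux, hbot⟩
    have hslope : Tendsto (slope u x) (𝓝[{z | u z = 0} ∩ Ioi x] x) (𝓝 (deriv u x)) :=
      (hasDerivAt_iff_tendsto_slope.1 hd.hasDerivAt).mono_left
        (nhdsWithin_mono x fun z hz => ne_of_gt hz.2)
    refine tendsto_nhds_unique hslope (tendsto_const_nhds.congr' ?_)
    filter_upwards [self_mem_nhdsWithin] with z hz
    simp [slope, hux, show u z = 0 from hz.1]
  · exact deriv_zero_of_not_differentiableAt hd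

variable {E : Type*} [NormedAddCommGroup E] [InnerProductSpace ℝ E] {φ ψ : ℝ → ℝ} {p : ℝ}
  {I : Set ℝ} {B : ℝ → E →L[ℝ] E →L[ℝ] ℝ} {u : ℝ → E}

lemma deriv_radialMap_comp {x : ℝ} (hψ : ContDiffOn ℝ 1 ψ (Ioi 0))
    (hu : DifferentiableAt ℝ u x) (hx : u x ≠ 0) :
    deriv (radialMap ψ ∘ u) x = fderiv ℝ (radialMap ψ) (u x) (deriv u x) :=
  fderiv_comp_deriv x ((contDiffAt_radialMap hψ hx).differentiableAt one_ne_zero) hu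

lemma ae_deriv_radialMap_comp_eq_zero (ψ : ℝ → ℝ) (u : ℝ → E) :
    ∀ᵐ x, u x = 0 → deriv (radialMap ψ ∘ u) x = 0 := by
  filter_upwards [ae_deriv_eq_zero_of_eq_zero (radialMap ψ ∘ u)] with x hx hux
  exact hx (by rw [Function.comp_apply, hux, radialMap_zero])

lemma IsRadialWeight.isFormDissipative (hφ : IsRadialWeight φ p)
    (h : ∀ᵐ x ∂volume.restrict I, StretchNonneg p (B x)) : IsFormDissipative φ I B := by
  intro u hu _
  refine integral_nonneg_of_ae ?_
  filter_upwards [h, ae_restrict_of_ae (ae_deriv_radialMap_comp_eq_zero φ u)] with x hx hzero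
  by_cases hux : u x = 0
  · simp [hzero hux]
  have hnorm := norm_pos_iff.2 hux
  rw [deriv_radialMap_comp hφ.contDiffOn (hu.1.differentiable one_ne_zero x) hux]
  exact StretchNonneg.apply_fderiv_radialMap_nonneg hux (hφ.differentiableAt hnorm)
    (hφ.pos _ hnorm) (hx.of_mem_uIcc hφ.limit_pos (uIcc_one_subset_uIcc_inv hφ.limit_pos
      (hφ.elasticity_mem_uIcc _ hnorm))) _

theorem IsRadialWeight.isFormDissipative_iff [SecondCountableTopology E]
    (hφ : IsRadialWeight φ p) (hI : IsOpen I) (hB : LocallyIntegrableOn B I) :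
    IsFormDissipative φ I B ↔ ∀ᵐ x ∂volume.restrict I, StretchNonneg p (B x) :=
  ⟨fun hd => hd.ae_stretchNonneg hφ hI hB, hφ.isFormDissipative⟩

end Sufficiency

section Strictness

set_option maxSynthPendingDepth 3

open scoped RealInnerProductSpace

variable {E : Type*} [NormedAddCommGroup E] [InnerProductSpace ℝ E] {φ : ℝ → ℝ} {p κ : ℝ}
  {I : Set ℝ} {B : ℝ → E →L[ℝ] E →L[ℝ] ℝ} {u : ℝ → E}

namespace IsRadialWeight

lemma contDiffOn_sqrt (hφ : IsRadialWeight φ p) : ContDiffOn ℝ 1 (fun s => √(φ s)) (Ioi 0) :=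
  hφ.contDiffOn.sqrt fun s hs => (hφ.pos s hs).ne'

lemma inner_fderiv_radialMap (hφ : IsRadialWeight φ p) {y : E} (hy : y ≠ 0) (c : ℝ) {η : E}
    (hη : ⟪y, η⟫ = 0) :
    ⟪c • y + η, fderiv ℝ (radialMap φ) y (c • y + η)⟫ =
      φ ‖y‖ * (elasticity φ ‖y‖ * ‖c • y‖ ^ 2 + ‖η‖ ^ 2) := by
  have hnorm := norm_pos_iff.2 hy
  rw [fderiv_radialMap_smul_add hy (hφ.differentiableAt hnorm) (hφ.pos _ hnorm).ne' c hη]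
  have hcy : ⟪c • y, η⟫ = 0 := by rw [inner_smul_left, hη, mul_zero]
  generalize c • y = ξ at hcy
  simp only [inner_smul_right, inner_add_left, inner_add_right, hcy, real_inner_comm ξ η,
    real_inner_self_eq_norm_sq]
  ring

lemma norm_sq_fderiv_radialMap_sqrt (hφ : IsRadialWeight φ p) {y : E} (hy : y ≠ 0) (c : ℝ) {η : E}
    (hη : ⟪y, η⟫ = 0) :
    ‖fderiv ℝ (radialMap fun s => √(φ s)) y (c • y + η)‖ ^ 2 =
      φ ‖y‖ * (((1 + elasticity φ ‖y‖) / 2) ^ 2 * ‖c • y‖ ^ 2 + ‖η‖ ^ 2) := by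
  have hnorm := norm_pos_iff.2 hy
  have hpos := hφ.pos _ hnorm
  rw [fderiv_radialMap_smul_add hy ((hφ.differentiableAt hnorm).sqrt hpos.ne')
    (Real.sqrt_pos.2 hpos).ne' c hη, elasticity_sqrt (hφ.differentiableAt hnorm) hpos, norm_smul,
    mul_pow, Real.norm_of_nonneg (Real.sqrt_nonneg _), Real.sq_sqrt hpos.le,
    norm_add_sq_real, norm_smul (_ / _), mul_pow, Real.norm_eq_abs, sq_abs, inner_smul_left,
    inner_smul_left, hη]
  ring

lemma inner_fderiv_radialMap_le (hφ : IsRadialWeight φ p) {y : E} (hy : y ≠ 0) (l : E) :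
    ⟪l, fderiv ℝ (radialMap φ) y l⟫ ≤ ‖fderiv ℝ (radialMap fun s => √(φ s)) y l‖ ^ 2 := by
  obtain ⟨c, η, hη, rfl⟩ := exists_smul_add_orthogonal y l
  rw [hφ.inner_fderiv_radialMap hy c hη, hφ.norm_sq_fderiv_radialMap_sqrt hy c hη]
  have := (hφ.pos _ (norm_pos_iff.2 hy)).le
  gcongr
  linarith [sq_nonneg ((1 - elasticity φ ‖y‖) / 2)]

lemma norm_sq_fderiv_radialMap_sqrt_le (hφ : IsRadialWeight φ p) {y : E} (hy : y ≠ 0) (l : E) :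
    ‖fderiv ℝ (radialMap fun s => √(φ s)) y l‖ ^ 2 ≤
      (1 + p) ^ 2 / (4 * p) * ⟪l, fderiv ℝ (radialMap φ) y l⟫ := by
  obtain ⟨c, η, hη, rfl⟩ := exists_smul_add_orthogonal y l
  rw [hφ.inner_fderiv_radialMap hy c hη, hφ.norm_sq_fderiv_radialMap_sqrt hy c hη]
  have hp := hφ.limit_pos
  have hnorm := norm_pos_iff.2 hy
  have hk : p * ((1 + p) ^ 2 / (4 * p)) = ((1 + p) / 2) ^ 2 := by field_simp; norm_num
  have hradial : ((1 + elasticity φ ‖y‖) / 2) ^ 2 ≤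
      elasticity φ ‖y‖ * ((1 + p) ^ 2 / (4 * p)) := by
    have := sq_mul_add_le_of_mem_uIcc (b := 1 / 2) (c := 1 / 2) hp
      (by rw [hk]; exact le_of_eq (by ring)) (by rw [hk]; exact le_of_eq (by ring))
      (uIcc_one_subset_uIcc_inv hp (hφ.elasticity_mem_uIcc _ hnorm))
    exact (le_of_eq (by ring)).trans this
  have htangential : 1 ≤ (1 + p) ^ 2 / (4 * p) := by
    rw [le_div_iff₀ (by positivity)]
    linarith [sq_nonneg (1 - p)]
  have := hφ.pos _ hnorm
  calc φ ‖y‖ * (((1 + elasticity φ ‖y‖) / 2) ^ 2 * ‖c • y‖ ^ 2 + ‖η‖ ^ 2)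
      ≤ φ ‖y‖ * (elasticity φ ‖y‖ * ((1 + p) ^ 2 / (4 * p)) * ‖c • y‖ ^ 2 +
          (1 + p) ^ 2 / (4 * p) * ‖η‖ ^ 2) := by
        gcongr
        exact le_mul_of_one_le_left (sq_nonneg _) htangential
    _ = _ := by ring

lemma ae_inner_deriv_radialMap_le (hφ : IsRadialWeight φ p) (hu : IsTestCurve I u) :
    ∀ᵐ x, ⟪deriv u x, deriv (radialMap φ ∘ u) x⟫ ≤
        ‖deriv (radialMap (fun s => √(φ s)) ∘ u) x‖ ^ 2 ∧
      ‖deriv (radialMap (fun s => √(φ s)) ∘ u) x‖ ^ 2 ≤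
        (1 + p) ^ 2 / (4 * p) * ⟪deriv u x, deriv (radialMap φ ∘ u) x⟫ := by
  filter_upwards [ae_deriv_radialMap_comp_eq_zero φ u,
    ae_deriv_radialMap_comp_eq_zero (fun s => √(φ s)) u] with x hzero hzero_sqrt
  by_cases hux : u x = 0
  · simp [hzero hux, hzero_sqrt hux]
  have hdiff := hu.1.differentiable one_ne_zero x
  rw [deriv_radialMap_comp hφ.contDiffOn hdiff hux,
    deriv_radialMap_comp hφ.contDiffOn_sqrt hdiff hux]
  exact ⟨hφ.inner_fderiv_radialMap_le hux _, hφ.norm_sq_fderiv_radialMap_sqrt_le hux _⟩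

end IsRadialWeight

/-- The abstract form of `IsStrictPhiDissipative`, for a field `B` of real bilinear forms on a real
inner product space. -/
def IsStrictFormDissipative (φ : ℝ → ℝ) (I : Set ℝ) (B : ℝ → E →L[ℝ] E →L[ℝ] ℝ) : Prop :=
  ∃ κ : ℝ, 0 < κ ∧ ∀ u : ℝ → E, IsTestCurve I u → IsTestCurve I (radialMap φ ∘ u) →
    κ * ∫ x in I, ‖deriv (radialMap (fun s => √(φ s)) ∘ u) x‖ ^ 2 ≤
      ∫ x in I, B x (deriv u x) (deriv (radialMap φ ∘ u) x)

lemma IsTestCurve.integrable_inner {w : ℝ → E} (hu : IsTestCurve I u) (hw : IsTestCurve I w) :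
    Integrable fun x => ⟪deriv u x, deriv w x⟫ :=
  hu.integrable_bilin (B := fun _ => innerForm E)
    ((locallyIntegrable_const (innerForm E)).locallyIntegrableOn I) hw

lemma isFormDissipative_sub_smul_innerForm_iff (hB : LocallyIntegrableOn B I) :
    IsFormDissipative φ I (fun x => B x - κ • innerForm E) ↔
      ∀ u : ℝ → E, IsTestCurve I u → IsTestCurve I (radialMap φ ∘ u) →
        κ * ∫ x in I, ⟪deriv u x, deriv (radialMap φ ∘ u) x⟫ ≤
          ∫ x in I, B x (deriv u x) (deriv (radialMap φ ∘ u) x) := by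
  refine forall₃_congr fun u hu hw => ?_
  rw [← sub_nonneg (b := κ * _), ← integral_const_mul,
    ← integral_sub (hu.integrable_bilin hB hw).integrableOn
      ((hu.integrable_inner hw).const_mul κ).integrableOn]
  rfl

section EnergyComparison

variable (hφ : IsRadialWeight φ p) (hu : IsTestCurve I u) (hw : IsTestCurve I (radialMap φ ∘ u))
include hφ hu hw

lemma IsRadialWeight.integral_norm_sq_deriv_radialMap_sqrt_le :
    ∫ x in I, ‖deriv (radialMap (fun s => √(φ s)) ∘ u) x‖ ^ 2 ≤
      (1 + p) ^ 2 / (4 * p) * ∫ x in I, ⟪deriv u x, deriv (radialMap φ ∘ u) x⟫ := by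
  rw [← integral_const_mul]
  refine integral_mono_of_nonneg (Eventually.of_forall fun x => sq_nonneg _)
    ((hu.integrable_inner hw).const_mul _).integrableOn (ae_restrict_of_ae ?_)
  exact (hφ.ae_inner_deriv_radialMap_le hu).mono fun x hx => hx.2

lemma IsRadialWeight.integral_inner_deriv_radialMap_le [CompleteSpace E] :
    ∫ x in I, ⟪deriv u x, deriv (radialMap φ ∘ u) x⟫ ≤
      ∫ x in I, ‖deriv (radialMap (fun s => √(φ s)) ∘ u) x‖ ^ 2 := by
  have hae := hφ.ae_inner_deriv_radialMap_le hu
  have hint : Integrable fun x => ‖deriv (radialMap (fun s => √(φ s)) ∘ u) x‖ ^ 2 := by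
    refine ((hu.integrable_inner hw).const_mul ((1 + p) ^ 2 / (4 * p))).mono'
      ((aestronglyMeasurable_deriv _ _).norm.pow 2) (hae.mono fun x hx => ?_)
    rw [Real.norm_of_nonneg (sq_nonneg _)]
    exact hx.2
  exact integral_mono_ae (hu.integrable_inner hw).integrableOn hint.integrableOn
    (ae_restrict_of_ae (hae.mono fun x hx => hx.1))

end EnergyComparison

theorem IsRadialWeight.isStrictFormDissipative_iff [CompleteSpace E] (hφ : IsRadialWeight φ p)
    (hB : LocallyIntegrableOn B I) :
    IsStrictFormDissipative φ I B ↔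
      ∃ κ : ℝ, 0 < κ ∧ IsFormDissipative φ I fun x => B x - κ • innerForm E := by
  have hp := hφ.limit_pos
  constructor
  · rintro ⟨κ, hκ, h⟩
    exact ⟨κ, hκ, (isFormDissipative_sub_smul_innerForm_iff hB).2 fun u hu hw =>
      (mul_le_mul_of_nonneg_left (hφ.integral_inner_deriv_radialMap_le hu hw) hκ.le).trans
        (h u hu hw)⟩
  · rintro ⟨κ, hκ, hd⟩
    refine ⟨κ / ((1 + p) ^ 2 / (4 * p)), by positivity, fun u hu hw => ?_⟩
    rw [div_mul_eq_mul_div, mul_div_assoc]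
    refine le_trans (mul_le_mul_of_nonneg_left ?_ hκ.le)
      ((isFormDissipative_sub_smul_innerForm_iff hB).1 hd u hu hw)
    rw [div_le_iff₀' (by positivity)]
    exact hφ.integral_norm_sq_deriv_radialMap_sqrt_le hu hw

theorem exists_isFormDissipative_sub_iff_shearForm [SecondCountableTopology E] {L : ℝ}
    (hφ : IsRadialWeight φ ((1 - L) / (1 + L))) (hI : IsOpen I) (hB : LocallyIntegrableOn B I) :
    (∃ κ : ℝ, 0 < κ ∧ IsFormDissipative φ I fun x => B x - κ • innerForm E) ↔
      ∃ κ : ℝ, 0 < κ ∧ ∀ᵐ x ∂volume.restrict I, ∀ ξ ω : E, ‖ω‖ = 1 →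
        κ * ‖ξ‖ ^ 2 ≤ shearForm L (B x) ξ ω := by
  have hL := one_sub_div_one_add_pos_iff.1 hφ.limit_pos
  have hiff (κ : ℝ) := hφ.isFormDissipative_iff (B := fun x => B x - κ • innerForm E) hI
    (hB.sub ((locallyIntegrable_const (κ • innerForm E)).locallyIntegrableOn I))
  constructor
  · rintro ⟨κ, hκ, hd⟩
    exact ⟨κ * (1 - L ^ 2), mul_pos hκ (sub_pos.2 hL), ((hiff κ).1 hd).mono
      fun x hx ξ ω hω => hx.mul_norm_sq_le_shearForm hL hκ.le hω⟩
  · rintro ⟨κ, hκ, h⟩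
    exact ⟨κ, hκ, (hiff κ).2 (h.mono
      fun x hx => StretchNonneg.of_mul_norm_sq_le_shearForm hL hκ.le hx)⟩

end Strictness

section MatrixForms

set_option maxSynthPendingDepth 3

open scoped RealInnerProductSpace

variable {m : ℕ}

lemma re_inner_eq_real_inner (ξ η : CVec m) : (inner ℂ ξ η).re = ⟪ξ, η⟫ := by
  simp only [PiLp.inner_apply, Complex.re_sum]
  rfl

/-- `(ξ, η) ↦ Re ⟨M ξ, η⟩` as a real bilinear form, depending linearly on the matrix `M`. -/
noncomputable def reSesqForm : Matrix (Fin m) (Fin m) ℂ →ₗ[ℝ] CVec m →L[ℝ] CVec m →L[ℝ] ℝ where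
  toFun M := innerForm (CVec m) ∘L (Matrix.toEuclideanCLM (𝕜 := ℂ) M).restrictScalars ℝ
  map_add' M N := by ext ξ η; simp
  map_smul' c M := by
    have hsmul : Matrix.toEuclideanCLM (𝕜 := ℂ) (c • M) = c • Matrix.toEuclideanCLM (𝕜 := ℂ) M := by
      rw [← Complex.coe_smul, map_smul, Complex.coe_smul]
    ext ξ η
    simp [hsmul]

lemma reSesqForm_apply (M : Matrix (Fin m) (Fin m) ℂ) (ξ η : CVec m) :
    reSesqForm M ξ η = (sesq M ξ η).re := by
  rw [sesq, ← inner_conj_symm, Complex.conj_re, re_inner_eq_real_inner]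
  rfl

lemma reSesqForm_sub_smul_one (M : Matrix (Fin m) (Fin m) ℂ) (κ : ℝ) :
    reSesqForm (M - (κ : ℂ) • 1) = reSesqForm M - κ • innerForm (CVec m) := by
  have hone : reSesqForm (1 : Matrix (Fin m) (Fin m) ℂ) = innerForm (CVec m) := by
    ext ξ η
    simp [reSesqForm]
  rw [map_sub, ← hone, ← map_smul, Complex.coe_smul]

lemma formP_eq_shearForm (L : ℝ) (M : Matrix (Fin m) (Fin m) ℂ) (ξ ω : CVec m) :
    formP L M ξ ω = shearForm L (reSesqForm M) ξ ω := by
  rw [formP, re_inner_eq_real_inner, Complex.sub_re]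
  simp only [← reSesqForm_apply, shearForm, map_add, map_sub, map_smul, add_apply, smul_apply,
    smul_eq_mul]
  ring

variable {I : Set ℝ} {𝒜 : ℝ → Matrix (Fin m) (Fin m) ℂ} {φ : ℝ → ℝ}

lemma locallyIntegrableOn_reSesqForm (hI : IsOpen I)
    (h𝒜 : ∀ i j, LocallyIntegrableOn (fun x => 𝒜 x i j) I) :
    LocallyIntegrableOn (fun x => reSesqForm (𝒜 x)) I := by
  rw [locallyIntegrableOn_iff hI.isLocallyClosed]
  intro K hKI hK
  have hsum : ∀ x, reSesqForm (𝒜 x) = ∑ i, ∑ j,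
      (reSesqForm.comp (Matrix.singleLinearMap ℝ i j)).toContinuousLinearMap (𝒜 x i j) := by
    intro x
    conv_lhs => rw [Matrix.matrix_eq_sum_single (𝒜 x)]
    simp only [map_sum, LinearMap.coe_toContinuousLinearMap', LinearMap.comp_apply]
    rfl
  simp only [IntegrableOn, hsum]
  exact integrable_finsetSum _ fun i _ => integrable_finsetSum _ fun j _ =>
    ContinuousLinearMap.integrable_comp _ ((h𝒜 i j).integrableOn_compact_subset hKI hK)

lemma IsTestCurve.integrable_sesq (hI : IsOpen I)
    (h𝒜 : ∀ i j, LocallyIntegrableOn (fun x => 𝒜 x i j) I) {u w : ℝ → CVec m}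
    (hu : IsTestCurve I u) (hw : IsTestCurve I w) :
    Integrable fun x => sesq (𝒜 x) (deriv u x) (deriv w x) := by
  have him : ∀ x, (sesq (𝒜 x) (deriv u x) (deriv w x)).im =
      reSesqForm (-Complex.I • 𝒜 x) (deriv u x) (deriv w x) := by
    intro x
    rw [reSesqForm_apply, sesq, sesq]
    simp [inner_smul_right]
  refine Integrable.re_im_iff.1 ⟨?_, ?_⟩
  · simpa only [reSesqForm_apply, RCLike.re_eq_complex_re] using
      hu.integrable_bilin (locallyIntegrableOn_reSesqForm hI h𝒜) hw
  · have hrotated : LocallyIntegrableOn (fun x => reSesqForm (-Complex.I • 𝒜 x)) I :=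
      locallyIntegrableOn_reSesqForm hI fun i j => (h𝒜 i j).smul (-Complex.I)
    simpa only [RCLike.im_eq_complex_im, him] using hu.integrable_bilin hrotated hw

lemma IsTestCurve.re_setIntegral_sesq (hI : IsOpen I)
    (h𝒜 : ∀ i j, LocallyIntegrableOn (fun x => 𝒜 x i j) I) {u w : ℝ → CVec m}
    (hu : IsTestCurve I u) (hw : IsTestCurve I w) :
    (∫ x in I, sesq (𝒜 x) (deriv u x) (deriv w x)).re =
      ∫ x in I, reSesqForm (𝒜 x) (deriv u x) (deriv w x) := by
  simp only [reSesqForm_apply]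
  exact (integral_re (hu.integrable_sesq hI h𝒜 hw).integrableOn).symm

lemma isPhiDissipative_iff_isFormDissipative (hI : IsOpen I)
    (h𝒜 : ∀ i j, LocallyIntegrableOn (fun x => 𝒜 x i j) I) :
    IsPhiDissipative φ I 𝒜 ↔ IsFormDissipative φ I fun x => reSesqForm (𝒜 x) :=
  forall₃_congr fun _ hu hv =>
    iff_of_eq (congrArg (0 ≤ ·) (IsTestCurve.re_setIntegral_sesq hI h𝒜 hu hv))

lemma isStrictPhiDissipative_iff_isStrictFormDissipative (hI : IsOpen I)
    (h𝒜 : ∀ i j, LocallyIntegrableOn (fun x => 𝒜 x i j) I) :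
    IsStrictPhiDissipative φ I 𝒜 ↔ IsStrictFormDissipative φ I fun x => reSesqForm (𝒜 x) :=
  exists_congr fun _ => and_congr_right fun _ => forall₃_congr fun _ hu hv =>
    iff_of_eq (congrArg (_ ≤ ·) (IsTestCurve.re_setIntegral_sesq hI h𝒜 hu hv))

lemma isPhiDissipative_sub_smul_one_iff (hI : IsOpen I)
    (h𝒜 : ∀ i j, LocallyIntegrableOn (fun x => 𝒜 x i j) I) (κ : ℝ) :
    IsPhiDissipative φ I (fun x => 𝒜 x - (κ : ℂ) • 1) ↔
      IsFormDissipative φ I fun x => reSesqForm (𝒜 x) - κ • innerForm (CVec m) := by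
  simp only [← reSesqForm_sub_smul_one]
  have hconst : ∀ i j, LocallyIntegrableOn
      (fun _ => ((κ : ℂ) • (1 : Matrix (Fin m) (Fin m) ℂ)) i j) I :=
    fun i j => (locallyIntegrable_const _).locallyIntegrableOn I
  exact isPhiDissipative_iff_isFormDissipative hI fun i j => (h𝒜 i j).sub (hconst i j)

end MatrixForms

section EssentialInfimum

open scoped RealInnerProductSpace

lemma essInf_prod_pos_iff {X Y : Type*} [MeasurableSpace X] [TopologicalSpace Y]
    [MeasurableSpace Y] (μ : Measure X) (ν : Measure Y) [SFinite ν] [ν.IsOpenPosMeasure]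
    {f : X → Y → ℝ} (hf : ∀ x, Continuous (f x)) :
    0 < essInf (fun z : X × Y => (f z.1 z.2 : EReal)) (μ.prod ν) ↔
      ∃ κ : ℝ, 0 < κ ∧ ∀ᵐ x ∂μ, ∀ y, κ ≤ f x y := by
  refine ⟨fun h => ?_, fun ⟨κ, hκ, h⟩ => ?_⟩
  · obtain ⟨κ, hκ, hlt⟩ := EReal.lt_iff_exists_real_btwn.1 h
    refine ⟨κ, by exact_mod_cast hκ, ?_⟩
    filter_upwards [Measure.ae_ae_of_ae_prod (ae_lt_of_lt_essInf hlt)] with x hx y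
    -- The inequality holds on a dense set of `y`, hence everywhere by continuity.
    exact closure_minimal (fun z hz => (EReal.coe_lt_coe_iff.1 hz).le)
      (isClosed_le continuous_const (hf x)) (Measure.dense_of_ae hx y)
  · have hκ' : (0 : EReal) < κ := by exact_mod_cast hκ
    refine hκ'.trans_le (le_essInf_of_ae_le _ ?_)
    filter_upwards [Measure.quasiMeasurePreserving_fst.ae h] with z hz
    exact EReal.coe_le_coe_iff.2 (hz z.2)

lemma shearForm_smul_left {E : Type*} [NormedAddCommGroup E] [InnerProductSpace ℝ E] (L c : ℝ)
    (B : E →L[ℝ] E →L[ℝ] ℝ) (ξ ω : E) : shearForm L B (c • ξ) ω = c ^ 2 * shearForm L B ξ ω := by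
  simp only [shearForm, map_add, map_sub, map_smul, add_apply, smul_apply, smul_eq_mul,
    inner_smul_right]
  ring

lemma shearForm_bound_iff_sphere {E : Type*} [NormedAddCommGroup E] [InnerProductSpace ℝ E]
    {L κ : ℝ} {B : E →L[ℝ] E →L[ℝ] ℝ} :
    (∀ ξ ω : E, ‖ω‖ = 1 → κ * ‖ξ‖ ^ 2 ≤ shearForm L B ξ ω) ↔
      ∀ y : Metric.sphere (0 : E) 1 × Metric.sphere (0 : E) 1, κ ≤ shearForm L B y.1 y.2 := by
  refine ⟨fun h y => ?_, fun h ξ ω hω => ?_⟩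
  · simpa using h y.1 y.2 (mem_sphere_zero_iff_norm.1 y.2.2)
  · rcases eq_or_ne ξ 0 with rfl | hξ
    · simp [shearForm]
    · have hunit : ‖‖ξ‖⁻¹ • ξ‖ = 1 := norm_smul_inv_norm (𝕜 := ℝ) hξ
      have hbound := h ⟨⟨‖ξ‖⁻¹ • ξ, mem_sphere_zero_iff_norm.2 hunit⟩,
        ⟨ω, mem_sphere_zero_iff_norm.2 hω⟩⟩
      simp only [shearForm_smul_left] at hbound
      rwa [inv_pow, inv_mul_eq_div, le_div_iff₀ (by positivity)] at hbound

lemma essInfP_pos_iff {m : ℕ} (L : ℝ) (I : Set ℝ) (𝒜 : ℝ → Matrix (Fin m) (Fin m) ℂ) :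
    0 < essInfP L I 𝒜 ↔ ∃ κ : ℝ, 0 < κ ∧ ∀ᵐ x ∂volume.restrict I,
      ∀ ξ ω : CVec m, ‖ω‖ = 1 → κ * ‖ξ‖ ^ 2 ≤ formP L (𝒜 x) ξ ω := by
  have hopen : ((volume : Measure (CVec m)).toSphere.prod
      (volume : Measure (CVec m)).toSphere).IsOpenPosMeasure := Measure.prod.instIsOpenPosMeasure
  have hcont : ∀ x, Continuous
      fun y : Metric.sphere (0 : CVec m) 1 × Metric.sphere (0 : CVec m) 1 =>
        formP L (𝒜 x) y.1 y.2 := by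
    intro x
    simp only [formP_eq_shearForm, shearForm]
    fun_prop
  rw [essInfP, essInf_prod_pos_iff _ _ hcont]
  simp only [formP_eq_shearForm, shearForm_bound_iff_sphere]

end EssentialInfimum

lemma isOpen_openInterval (a b : EReal) : IsOpen (openInterval a b) :=
  (isOpen_lt continuous_const continuous_coe_real_ereal).inter
    (isOpen_lt continuous_coe_real_ereal continuous_const)

theorem mainTheorem5_general {φ : ℝ → ℝ} {L : ℝ} (hφ : IsRadialWeight φ ((1 - L) / (1 + L)))
    {m : ℕ} {I : Set ℝ} (hI : IsOpen I) {𝒜 : ℝ → Matrix (Fin m) (Fin m) ℂ}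
    (h𝒜 : ∀ i j, LocallyIntegrableOn (fun x => 𝒜 x i j) I) :
    (IsStrictPhiDissipative φ I 𝒜 ↔
      ∃ κ : ℝ, 0 < κ ∧ ∀ᵐ x ∂volume.restrict I,
        ∀ ξ ω : CVec m, ‖ω‖ = 1 → κ * ‖ξ‖ ^ 2 ≤ formP L (𝒜 x) ξ ω) ∧
    ((∃ κ : ℝ, 0 < κ ∧ IsPhiDissipative φ I (fun x => 𝒜 x - (κ : ℂ) • 1)) ↔
      0 < essInfP L I 𝒜) := by
  have hB := locallyIntegrableOn_reSesqForm hI h𝒜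
  have hpointwise := exists_isFormDissipative_sub_iff_shearForm hφ hI hB
  constructor
  · rw [isStrictPhiDissipative_iff_isStrictFormDissipative hI h𝒜,
      hφ.isStrictFormDissipative_iff hB, hpointwise]
    simp only [formP_eq_shearForm]
  · rw [essInfP_pos_iff]
    simp only [isPhiDissipative_sub_smul_one_iff hI h𝒜, formP_eq_shearForm]
    exact hpointwise

theorem mainTheorem5 (φ : ℝ → ℝ) (hφ : PhiAdmissible φ)
    (hΛ : capLambdaInf φ ^ 2 < 1)
    (m : ℕ) (a b : EReal) (hab : a < b)
    (𝒜 : ℝ → Matrix (Fin m) (Fin m) ℂ)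
    (h𝒜 : ∀ i j, LocallyIntegrableOn (fun x => 𝒜 x i j) (openInterval a b) volume) :
    (IsStrictPhiDissipative φ (openInterval a b) 𝒜 ↔
      ∃ κ : ℝ, 0 < κ ∧ ∀ᵐ x ∂(volume.restrict (openInterval a b)),
        ∀ ξ ω : CVec m, ‖ω‖ = 1 → κ * ‖ξ‖ ^ 2 ≤ formP (capLambdaInf φ) (𝒜 x) ξ ω) ∧
    ((∃ κ : ℝ, 0 < κ ∧
        IsPhiDissipative φ (openInterval a b) (fun x => 𝒜 x - (κ : ℂ) • 1)) ↔
      0 < essInfP (capLambdaInf φ) (openInterval a b) 𝒜) :=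
  mainTheorem5_general (hφ.isRadialWeight hΛ) (isOpen_openInterval a b) h𝒜
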